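/- Setting. Let $K\subset\mathbb R^d$ be a non-empty, connected, compact set with $K=\bigcup_{i=1}^N F_i(K)$, where $|F_i(x)-F_i(y)|=\lambda_i|x-y|$, $0<\lambda_i<1$. For a word $w=(w_1,\dots,w_n)$ put $F_w=F_{w_1}\circ\dots\circ F_{w_n}$ and $K_w=F_w(K)$ (an $n$-cell). Assume $\mathcal C=\bigcup_{i\ne j}K_i\cap K_j\neq\emptyset$ and that $V_0=\bigcup_{|w|\ge1}\{x\in K: F_w(x)\in\mathcal C\}$ is finite ($K$ is p.c.f., with boundary $V_0$). Let $V_n=\bigcup_iF_i(V_{n-1})$. Let $K$ carry a harmonic structure: symmetric conductances $c^n_{xy}\ge0$ on $V_n$ and $0<r_i<1$ such that the energies $\mathcal E_n(u)=\sum_{x,y\in V_n}c^n_{xy}\tfrac12(u(y)-u(x))^2$ satisfy $\mathcal E_n(u)=\sum_i r_i^{-1}\mathcal E_{n-1}(u\circ F_i)$ and $\mathcal E_{n-1}(u)=\min\{\mathcal E_n(\bar u):\bar u|_{V_{n-1}}=u\}$, and $\mathcal E_0(u)=0$ only for $u$ constant on $V_0$. Let $\Gamma_n$ be the graph on $V_n$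 in which $x\neq y$ are adjacent iff $c^n_{xy}>0$. Let $\mathbb T=\mathbb R/\mathbb Z$, and for $\theta\in\mathbb T$ let $[\theta]\in(-\frac12,\frac12]$ be its representative. For $f\in C(K,\mathbb T)$ put $\Delta_nf(x)=\sum_{y\in V_n}c^n_{xy}[f(y)-f(x)]$. Call $f$ a harmonic map if, for all sufficiently large $n$, $\Delta_nf=0$ on $V_n\setminus V_0$; its normal derivative at $v\in V_0$ is $\partial_{\mathbf n}f(v)=\lim_n\Delta_nf(v)$. Cycles and cuts. Fix $m\ge0$ and cycles $\gamma_1,\dots,\gamma_{n_m}$ forming a basis of the cycle space of $\Gamma_m$ (over $\mathbb Z$, or any nontrivial commutative ring). Assume there are cycles $\iota(\gamma_i)$ of $\Gamma_{m+1}$ with $V(\gamma_i)\subset V(\iota(\gamma_i))$ and vertices $\xi_i\in V(\iota(\gamma_i))$ with $\xi_i\notin V(\iota(\gamma_j))$ for $j\ne i$. The cycle $\gamma_i$ is realised in $K$ by a loop $c_i:\mathbb T\to K$, starting at $\xi_i$, that visits the vertices of $\iota(\gamma_i)$ in order and stays in an $(m+1)$-cell between consecutive vertices. At each $\xi_i$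 the $(m+1)$-cells containing $\xi_i$ are divided into two classes, $+$ and $-$, such that $c_i$ leaves $\xi_i$ through a cell of class $-$ and returns to it through a cell of class $+$. The degree of $f\in C(K,\mathbb T)$ along $\gamma_i$ is $\omega_{\gamma_i}(f)=\deg(f\circ c_i)$. Covering space. Let $K^0$ be obtained from $K$ by cutting it at every $\xi_i$, that is, by replacing $\xi_i$ by two copies $z_i^+$ and $z_i^-$, the first attached to the cells of class $+$, the second to those of class $-$. For $\rho\in\mathbb Z^{n_m}$ let $\tilde K$ be the quotient of $K^0\times\mathbb Z$ under $(z_i^+,s)\simeq(z_i^-,s+\rho_i)$; $K^0$ is its fundamental domain. For $u:K^0\to\mathbb R$ and $n\ge m+1$ let $\mathcal E_n[\Gamma^0_n](u)=\sum_{|w|=m+1}r_w^{-1}\mathcal E_{n-m-1}(u\circ F_w)$, where $r_w=\prod_k r_{w_k}$ and $F_w$ is regarded as a map from $K$ onto the copy of $K_w$ in $K^0$, and let $\mathcal E_{K^0}(u)=\lim_n\mathcal E_n[\Gamma_n^0](u)\in[0,\infty]$. Fix $b\in K^0$ lying over a point of $V_0$ and call $u:K^0\to\mathbb R$ admissible if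 $u(b)=0$ and $u(z_i^+)=u(z_i^-)+\rho_i$ for all $i$. Theorem. For every $\rho=(\rho_1,\dots,\rho_{n_m})\in\mathbb Z^{n_m}$ there is a harmonic map $f:K\to\mathbb T$ with $\omega_{\gamma_i}(f)=\rho_i$ for $1\le i\le n_m$ and $\partial_{\mathbf n}f(v)=0$ for all $v\in V_0$. Moreover, $f$ can be chosen as follows: there are a continuous admissible $u:K^0\to\mathbb R$ of finite energy that minimises $\mathcal E_{K^0}$ among all continuous admissible functions, and $\mathcal E_n[\Gamma^0_n]$ among all admissible functions for every $n\ge m+1$, and a continuous $U:\tilde K\to\mathbb R$ with $U(x,s)=u(x)+s$ for $x\in K^0$, $s\in\mathbb Z$, such that $f$ at the point of $K$ below $x$ is $U(x,s)\bmod 1$. -/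

import Mathlib

open Set Filter Topology
open scoped ENNReal

noncomputable section

/-- A non-empty, connected, compact set `carrier ⊆ ℝᵈ` with `carrier = ⋃ i, F i '' carrier`, where
the `F i` are similitudes of `ℝᵈ` with ratios in `(0,1)`. -/
structure SelfSimilarSet (d N : ℕ) where
  carrier : Set (EuclideanSpace ℝ (Fin d))
  F : Fin N → EuclideanSpace ℝ (Fin d) → EuclideanSpace ℝ (Fin d)
  ratio : Fin N → ℝ
  isConnected : IsConnected carrier
  isCompact : IsCompact carrier
  ratio_pos : ∀ i, 0 < ratio i
  ratio_lt_one : ∀ i, ratio i < 1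
  dist_F : ∀ i x y, dist (F i x) (F i y) = ratio i * dist x y
  self_similar : carrier = ⋃ i, F i '' carrier

namespace SelfSimilarSet

variable {d N : ℕ} (S : SelfSimilarSet d N)

/-- The self-similar set as a topological space. -/
abbrev Pt : Type := ↥S.carrier

theorem F_mem (i : Fin N) {x : EuclideanSpace ℝ (Fin d)} (hx : x ∈ S.carrier) :
    S.F i x ∈ S.carrier := by
  rw [S.self_similar]
  exact mem_iUnion.2 ⟨i, x, hx, rfl⟩

/-- The contraction `F i`, as a self-map of the self-similar set. -/
def map (i : Fin N) (x : S.Pt) : S.Pt := ⟨S.F i x.1, S.F_mem i x.2⟩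

theorem continuous_map (i : Fin N) : Continuous (S.map i) := by
  have h : LipschitzWith (Real.toNNReal (S.ratio i)) (S.F i) := by
    refine LipschitzWith.of_dist_le_mul fun x y => ?_
    rw [S.dist_F, Real.coe_toNNReal _ (S.ratio_pos i).le]
  exact (h.continuous.comp continuous_subtype_val).subtype_mk _

/-- `F_w = F_{w 0} ∘ F_{w 1} ∘ ⋯` for a word `w` of length `n`. -/
def mapWord : {n : ℕ} → (Fin n → Fin N) → S.Pt → S.Pt
  | 0, _ => id
  | _ + 1, w => S.map (w 0) ∘ mapWord (Fin.tail w)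

theorem continuous_mapWord : ∀ {n : ℕ} (w : Fin n → Fin N), Continuous (S.mapWord w)
  | 0, _ => continuous_id
  | _ + 1, w => (S.continuous_map (w 0)).comp (continuous_mapWord (Fin.tail w))

/-- The `n`-cell `K_w`. -/
def cell {n : ℕ} (w : Fin n → Fin N) : Set S.Pt := range (S.mapWord w)

/-- The critical set `⋃_{i ≠ j} K_i ∩ K_j`. -/
def critical : Set S.Pt := ⋃ (i : Fin N) (j : Fin N) (_ : i ≠ j), range (S.map i) ∩ range (S.map j)

/-- The post-critical set: all `F_w`-preimages in `K` of critical points, over non-empty words. -/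
def postCritical : Set S.Pt := ⋃ (n : ℕ) (w : Fin (n + 1) → Fin N), S.mapWord w ⁻¹' S.critical

/-- The vertex sets `V_0 ⊆ V_1 ⊆ ⋯`; `V_0` is the boundary. -/
def V : ℕ → Set S.Pt
  | 0 => S.postCritical
  | n + 1 => ⋃ i, S.map i '' V n

end SelfSimilarSet

/-- A post-critically finite self-similar set. -/
structure PCFFractal (d N : ℕ) extends SelfSimilarSet d N where
  critical_nonempty : toSelfSimilarSet.critical.Nonempty
  postCritical_finite : toSelfSimilarSet.postCritical.Finite

namespace PCFFractal

variable {d N : ℕ} (S : PCFFractal d N)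

theorem V_finite : ∀ n, (S.V n).Finite
  | 0 => S.postCritical_finite
  | n + 1 => finite_iUnion fun i => (V_finite n).image (S.map i)

/-- `V_n` as a finset. -/
def vert (n : ℕ) : Finset S.Pt := (S.V_finite n).toFinset

/-- The Dirichlet form with conductances `a` on `V_n` (a sum over ordered pairs). It depends only
on the values on `V_n`. -/
def dirichlet (n : ℕ) (a : S.Pt → S.Pt → ℝ) (u : S.Pt → ℝ) : ℝ :=
  ∑ x ∈ S.vert n, ∑ y ∈ S.vert n, a x y * ((u y - u x) ^ 2 / 2)

end PCFFractal

/-- A (regular) harmonic structure: conductances `c n` on `V_n` and resistance scalings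
`0 < r i < 1` such that the Dirichlet forms are self-similar and compatible, and such that the
form on `V_0` vanishes on constants only. -/
structure HarmonicStructure {d N : ℕ} (S : PCFFractal d N) where
  c : ℕ → S.Pt → S.Pt → ℝ
  r : Fin N → ℝ
  c_nonneg : ∀ n, ∀ x ∈ S.V n, ∀ y ∈ S.V n, 0 ≤ c n x y
  c_symm : ∀ n, ∀ x ∈ S.V n, ∀ y ∈ S.V n, c n x y = c n y x
  r_pos : ∀ i, 0 < r i
  r_lt_one : ∀ i, r i < 1
  energy_succ : ∀ (n : ℕ) (u : S.Pt → ℝ),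
    S.dirichlet (n + 1) (c (n + 1)) u = ∑ i, (r i)⁻¹ * S.dirichlet n (c n) (u ∘ S.map i)
  energy_compatible : ∀ (n : ℕ) (u : S.Pt → ℝ),
    IsLeast {e : ℝ | ∃ v : S.Pt → ℝ, EqOn v u (S.V n) ∧ S.dirichlet (n + 1) (c (n + 1)) v = e}
      (S.dirichlet n (c n) u)
  irreducible : ∀ u : S.Pt → ℝ, S.dirichlet 0 (c 0) u = 0 → ∀ x ∈ S.V 0, ∀ y ∈ S.V 0, u x = u y

/-- The circle `ℝ/ℤ`. -/
abbrev Circ : Type := AddCircle (1 : ℝ)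

/-- The representative in `(-1/2, 1/2]` of a point of `ℝ/ℤ`. -/
def signedRep (θ : Circ) : ℝ := (AddCircle.equivIoc (1 : ℝ) (-1 / 2) θ : ℝ)

/-- A continuous map `ℝ/ℤ → ℝ/ℤ` has degree `k`: a continuous lift `ℝ → ℝ` increases by `k`
over `[0,1]`. -/
def HasDegree (g : C(Circ, Circ)) (k : ℤ) : Prop :=
  ∃ G : C(ℝ, ℝ), (∀ t : ℝ, ((G t : ℝ) : Circ) = g (t : Circ)) ∧ G 1 - G 0 = k

namespace HarmonicStructure

variable {d N : ℕ} {S : PCFFractal d N} (H : HarmonicStructure S)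

/-- The energy `𝓔_n`. -/
def energy (n : ℕ) (u : S.Pt → ℝ) : ℝ := S.dirichlet n (H.c n) u

/-- `r_w`, the product of the `r (w k)`. -/
def rWord {n : ℕ} (w : Fin n → Fin N) : ℝ := ∏ k, H.r (w k)

/-- The graph `Γ_n`; points outside `V_n` are isolated. -/
def graph (n : ℕ) : SimpleGraph S.Pt where
  Adj x y := x ≠ y ∧ x ∈ S.V n ∧ y ∈ S.V n ∧ 0 < H.c n x y
  symm := ⟨fun x y ⟨hne, hx, hy, hc⟩ => ⟨hne.symm, hy, hx, by rwa [H.c_symm n y hy x hx]⟩⟩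
  loopless := ⟨fun _ h => h.1 rfl⟩

/-- The `n`-th graph Laplacian of a circle-valued map: the differences `f y - f x` are represented
in `(-1/2, 1/2]`. For continuous `f` and large `n` this is the Laplacian of a real lift of `f`
near `x`, since adjacent vertices lie in a common `n`-cell. -/
def circleLaplacian (n : ℕ) (f : S.Pt → Circ) (x : S.Pt) : ℝ :=
  ∑ y ∈ S.vert n, H.c n x y * signedRep (f y - f x)

/-- `Δ f = 0` away from the boundary: the discrete Laplace equations hold on all sufficiently
fine levels. -/
def IsHarmonicMap (f : C(S.Pt, Circ)) : Prop :=
  ∀ᶠ n in atTop, ∀ x ∈ S.V n, x ∉ S.V 0 → H.circleLaplacian n f x = 0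

/-- The normal derivative of `f` at the boundary point `v` exists and equals `a`. -/
def HasNormalDeriv (f : C(S.Pt, Circ)) (v : S.Pt) (a : ℝ) : Prop :=
  Tendsto (fun n => H.circleLaplacian n f v) atTop (𝓝 a)

/-- The cycle space of `Γ_n` with coefficients in `R`: circulations on oriented edges. -/
def cycleSpace (R : Type*) [CommRing R] (n : ℕ) : Submodule R (S.Pt → S.Pt → R) where
  carrier := {φ | (∀ x y, φ x y = -φ y x) ∧ (∀ x y, ¬ (H.graph n).Adj x y → φ x y = 0) ∧
    ∀ x, ∑ y ∈ S.vert n, φ x y = 0}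
  zero_mem' := by simp
  add_mem' := by
    rintro φ ψ ⟨h1, h2, h3⟩ ⟨k1, k2, k3⟩
    refine ⟨fun x y => ?_, fun x y hxy => ?_, fun x => ?_⟩
    · simp only [Pi.add_apply]
      rw [h1 x y, k1 x y]
      ring
    · simp [h2 x y hxy, k2 x y hxy]
    · simp [Finset.sum_add_distrib, h3 x, k3 x]
  smul_mem' := by
    rintro a φ ⟨h1, h2, h3⟩
    refine ⟨fun x y => ?_, fun x y hxy => ?_, fun x => ?_⟩
    · simp only [Pi.smul_apply, smul_eq_mul]
      rw [h1 x y]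
      ring
    · simp [h2 x y hxy]
    · simp [← Finset.mul_sum, h3 x]

open Classical in
/-- The signed number of times a closed walk runs along each oriented edge. -/
def walkFlow (R : Type*) [CommRing R] {n : ℕ} {a : S.Pt} (p : (H.graph n).Walk a a) :
    S.Pt → S.Pt → R := fun x y =>
  (p.darts.countP (fun e => e.fst = x ∧ e.snd = y) : R) -
    (p.darts.countP (fun e => e.fst = y ∧ e.snd = x) : R)

/-- Cut data at level `m`: cycles `γ i` of `Γ_m`, cycles `ι i` of `Γ_{m+1}` through all vertices of
`γ i`, and cut vertices `cut i` on `ι i` but on no other `ι j`. A cycle has no distinguished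
starting point, so `ι i` is started at `cut i`. The cycles are realised in `K` by loops:
`loop i` runs through the vertices of `ι i` in order, at the times `time i k`, and between the
`k`-th and the next vertex stays in the `(m+1)`-cell `K_w`, `w = word i k`.

Cutting `K` at `cut i` distributes the `(m+1)`-cells that contain `cut i` over two copies of that
point: those with `w ∈ plus i` get the copy `+`, the others the copy `-`. The loop leaves
`cut i` through a cell at `-` and comes back to it through a cell at `+`. -/
structure CutData (m n : ℕ) where
  base : Fin n → S.Pt
  γ : ∀ i, (H.graph m).Walk (base i) (base i)
  γ_isCycle : ∀ i, (γ i).IsCycle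
  cut : Fin n → S.Pt
  ι : ∀ i, (H.graph (m + 1)).Walk (cut i) (cut i)
  ι_isCycle : ∀ i, (ι i).IsCycle
  support_subset : ∀ i, ∀ x ∈ (γ i).support, x ∈ (ι i).support
  cut_notMem : ∀ i j, j ≠ i → cut i ∉ (ι j).support
  loop : Fin n → C(Circ, S.Pt)
  time : Fin n → ℕ → ℝ
  word : Fin n → ℕ → (Fin (m + 1) → Fin N)
  time_zero : ∀ i, time i 0 = 0
  time_length : ∀ i, time i (ι i).length = 1
  time_le : ∀ i, ∀ k < (ι i).length, time i k ≤ time i (k + 1)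
  loop_time : ∀ i, ∀ k ≤ (ι i).length, loop i (time i k : ℝ) = (ι i).getVert k
  loop_mem_cell : ∀ i, ∀ k < (ι i).length, ∀ t ∈ Icc (time i k) (time i (k + 1)),
    loop i (t : ℝ) ∈ S.cell (word i k)
  plus : Fin n → Set (Fin (m + 1) → Fin N)
  first_notMem : ∀ i, word i 0 ∉ plus i
  last_mem : ∀ i, word i ((ι i).length - 1) ∈ plus i

namespace CutData

variable {H} {m n : ℕ} (D : H.CutData m n)

/-- The cycles `γ i` form a basis of the cycle space of `Γ_m` over `R`. -/
def IsCycleBasis (R : Type*) [CommRing R] : Prop :=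
  LinearIndependent R (fun i => H.walkFlow R (D.γ i)) ∧
    Submodule.span R (range fun i => H.walkFlow R (D.γ i)) = H.cycleSpace R m

/-- `(w, x)` stands for the point `F_w x` in the cell `K_w`. Points of different cells are glued
when they are the same point of `K`, except that cells on different sides of a cut vertex are
not glued there. -/
def domSetoid : Setoid ((Fin (m + 1) → Fin N) × S.Pt) where
  r p q := S.mapWord p.1 p.2 = S.mapWord q.1 q.2 ∧
    ∀ i, S.mapWord p.1 p.2 = D.cut i → (p.1 ∈ D.plus i ↔ q.1 ∈ D.plus i)
  iseqv :=
    { refl := fun _ => ⟨rfl, fun _ _ => Iff.rfl⟩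
      symm := fun h => ⟨h.1.symm, fun i hi => (h.2 i (h.1.trans hi)).symm⟩
      trans := fun h k => ⟨h.1.trans k.1, fun i hi =>
        (h.2 i hi).trans (k.2 i (h.1.symm.trans hi))⟩ }

/-- The fundamental domain `K⁰`: `K` cut open at the cut vertices. -/
def FundDomain : Type := Quotient D.domSetoid

instance : TopologicalSpace D.FundDomain :=
  inferInstanceAs (TopologicalSpace (Quotient D.domSetoid))

/-- The point `F_w x` in the copy of the cell `K_w` inside `K⁰`. -/
def pt (w : Fin (m + 1) → Fin N) (x : S.Pt) : D.FundDomain := Quotient.mk D.domSetoid (w, x)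

/-- The projection `K⁰ → K`. -/
def proj : D.FundDomain → S.Pt :=
  Quotient.lift (fun p => S.mapWord p.1 p.2) fun _ _ h => h.1

/-- `p` is the copy `+` of the `i`-th cut vertex. -/
def IsPlusCopy (i : Fin n) (p : D.FundDomain) : Prop :=
  ∃ w ∈ D.plus i, ∃ x, S.mapWord w x = D.cut i ∧ p = D.pt w x

/-- `p` is the copy `-` of the `i`-th cut vertex. -/
def IsMinusCopy (i : Fin n) (p : D.FundDomain) : Prop :=
  ∃ w ∉ D.plus i, ∃ x, S.mapWord w x = D.cut i ∧ p = D.pt w x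

/-- The energy `𝓔_{m+1+k}` on the graph of level `m+1+k` approximating `K⁰`, written, through the
self-similarity of the energies, as a sum over the `(m+1)`-cells of which `K⁰` consists. -/
def domEnergy (k : ℕ) (u : D.FundDomain → ℝ) : ℝ :=
  ∑ w : Fin (m + 1) → Fin N, (H.rWord w)⁻¹ * H.energy k (fun x => u (D.pt w x))

/-- The energy `𝓔_{K⁰}`, the limit of the non-decreasing sequence of the energies `domEnergy k`. -/
def limEnergy (u : D.FundDomain → ℝ) : ℝ≥0∞ := ⨆ k, ENNReal.ofReal (D.domEnergy k u)

/-- The constraints: `u` vanishes at the reference point `b` and jumps by `ρ i` at the `i`-th cut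
vertex. -/
def Admissible (ρ : Fin n → ℤ) (b : D.FundDomain) (u : D.FundDomain → ℝ) : Prop :=
  u b = 0 ∧ ∀ i p q, D.IsPlusCopy i p → D.IsMinusCopy i q → u p = u q + ρ i

/-- `u` is the energy minimiser on `K⁰` under the constraints: it has finite energy, it minimises
`𝓔_{K⁰}` among the continuous admissible functions, and its restriction to the vertices of each
level `≥ m+1` minimises the energy of that level among all admissible functions. -/
def IsEnergyMinimizer (ρ : Fin n → ℤ) (b : D.FundDomain) (u : C(D.FundDomain, ℝ)) : Prop :=
  D.Admissible ρ b u ∧ D.limEnergy u < ⊤ ∧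
    (∀ v : C(D.FundDomain, ℝ), D.Admissible ρ b v → D.limEnergy u ≤ D.limEnergy v) ∧
    ∀ (k : ℕ) (v : D.FundDomain → ℝ), D.Admissible ρ b v → D.domEnergy k u ≤ D.domEnergy k v

/-- The identification `(z_i^s)_+ ∼ (z_i^{s + ρ i})_-` of points on different sheets. -/
def SheetRel (ρ : Fin n → ℤ) (p q : D.FundDomain × ℤ) : Prop :=
  ∃ i, D.IsPlusCopy i p.1 ∧ D.IsMinusCopy i q.1 ∧ q.2 = p.2 + ρ i

/-- The covering space `K̃` of degree `ρ`: sheets `K⁰ × {s}`, `s ∈ ℤ`, glued at the cut vertices. -/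
def CoveringSpace (ρ : Fin n → ℤ) : Type := Quot (D.SheetRel ρ)

instance (ρ : Fin n → ℤ) : TopologicalSpace (D.CoveringSpace ρ) :=
  inferInstanceAs (TopologicalSpace (Quot (D.SheetRel ρ)))

/-- The point `p` on the sheet `s` of `K̃`. -/
def sheet (ρ : Fin n → ℤ) (s : ℤ) (p : D.FundDomain) : D.CoveringSpace ρ :=
  Quot.mk (D.SheetRel ρ) (p, s)

end CutData

end HarmonicStructure

end

/-!
The map `f` is the reduction modulo `1` of a function `u` on the cut space `K⁰` that minimises the
energy under the jump conditions at the cut vertices.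

*Existence of the minimiser.* On the coarsest level the energy is the square of the norm of a
linear map into a Euclidean space, so it attains its minimum among the admissible functions
(`exists_minimizer_domEnergy_zero`). Each cell then carries the continuous harmonic extension of
its boundary values (`HarmonicStructure.exists_harmonic_extension`). That extension is a uniform
limit of successive refinements: the values on the boundary of an `n`-cell oscillate by at most a
constant times the square root of `r_w` times the energy, which decays geometrically, as the
effective resistances between boundary points are finite (`finiteResistance_zero`,
`finiteResistance_one`). Harmonic extension preserves the energy, while the energy of any other
function does not decrease from level to level, so the function obtained minimises the energy of
every level and the limit energy (`exists_isEnergyMinimizer`).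

*Degree.* The jumps of `u` are integers, so `u` modulo `1` descends to `K`. The `i`-th loop lifts to
a path in `K⁰` from the copy `-` of its cut vertex to the copy `+`, along which `u` increases by
`ρ i` (`Admissible.hasDegree`).

*Harmonicity.* The energy identity determines the conductances of a fine level as sums of those of
the cells (`bondSum_add`), so every bond lies in a cell of its level, and across it `u` varies by
less than `1/2` on fine levels (`exists_abs_sub_lt`). Hence the circle-valued Laplacian at a vertex
is the first variation of the energy at `u` along the indicator of that vertex, and it vanishes
(`IsEnergyMinimizer.eventually_circleLaplacian_eq_zero`). Admissibility does not constrain such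
variations: they have equal values on both copies of a cut vertex, and the normalisation at `b`
only shifts them by a constant. So the Laplacian vanishes at the boundary too, and the normal
derivatives are zero.
-/

/-! ### Cells and vertices -/

/-- Continuous maps prescribed on finitely many compact pieces that cover a Hausdorff space, and
agreeing where the pieces meet, glue to a continuous map. -/
theorem ContinuousMap.exists_of_finite_cover {ι X Y Z : Type*} [Finite ι] [TopologicalSpace X]
    [CompactSpace X] [TopologicalSpace Y] [T2Space Y] [TopologicalSpace Z] (e : ι → X → Y)
    (he : ∀ i, Continuous (e i)) (hsurj : ∀ y, ∃ i x, e i x = y) (g : ι → X → Z)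
    (hg : ∀ i, Continuous (g i)) (hcompat : ∀ i j x y, e i x = e j y → g i x = g j y) :
    ∃ G : C(Y, Z), ∀ i x, G (e i x) = g i x := by
  let q : (Σ _ : ι, X) → Y := fun p => e p.1 p.2
  have hqc : Continuous q := continuous_sigma he
  have hqs : Function.Surjective q := fun y => by
    obtain ⟨i, x, h⟩ := hsurj y
    exact ⟨⟨i, x⟩, h⟩
  have hq : IsQuotientMap q := IsQuotientMap.of_surjective_continuous hqs hqc
  choose i x hix using hsurj
  have hG : ∀ j y, g (i (e j y)) (x (e j y)) = g j y := fun j y => hcompat _ _ _ _ (hix _)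
  refine ⟨⟨fun y => g (i y) (x y), hq.continuous_iff.2 ?_⟩, hG⟩
  have : (fun y => g (i y) (x y)) ∘ q = fun p : (Σ _ : ι, X) => g p.1 p.2 :=
    funext fun p => hG p.1 p.2
  rw [this]
  exact continuous_sigma hg

namespace SelfSimilarSet

variable {d N : ℕ} (S : SelfSimilarSet d N)

theorem map_injective (i : Fin N) : Function.Injective (S.map i) := by
  intro x y h
  have h1 : S.F i x.1 = S.F i y.1 := congrArg Subtype.val h
  have h2 := S.dist_F i x.1 y.1
  rw [h1, dist_self, zero_eq_mul, or_iff_right (S.ratio_pos i).ne'] at h2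
  exact Subtype.ext (dist_eq_zero.1 h2)

theorem mapWord_injective : ∀ {n : ℕ} (w : Fin n → Fin N), Function.Injective (S.mapWord w)
  | 0, _ => Function.injective_id
  | _ + 1, w => (S.map_injective (w 0)).comp (mapWord_injective (Fin.tail w))

theorem mapWord_succ {n : ℕ} (w : Fin (n + 1) → Fin N) (x : S.Pt) :
    S.mapWord w x = S.map (w 0) (S.mapWord (Fin.tail w) x) := rfl

theorem mapWord_cons {n : ℕ} (i : Fin N) (w : Fin n → Fin N) (x : S.Pt) :
    S.mapWord (Fin.cons i w : Fin (n + 1) → Fin N) x = S.map i (S.mapWord w x) := by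
  rw [mapWord_succ, Fin.cons_zero, Fin.tail_cons]

theorem exists_map_eq (x : S.Pt) : ∃ i y, S.map i y = x := by
  obtain ⟨i, y, hy, h⟩ := mem_iUnion.1 (S.self_similar.subset x.2)
  exact ⟨i, ⟨y, hy⟩, Subtype.ext h⟩

theorem exists_mapWord_eq : ∀ (n : ℕ) (x : S.Pt), ∃ (w : Fin n → Fin N) (y : S.Pt),
    S.mapWord w y = x
  | 0, x => ⟨Fin.elim0, x, rfl⟩
  | n + 1, x => by
    obtain ⟨i, y, rfl⟩ := S.exists_map_eq x
    obtain ⟨w, z, rfl⟩ := exists_mapWord_eq n y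
    exact ⟨Fin.cons i w, z, S.mapWord_cons i w z⟩

theorem mem_V_zero_of_map_eq {i j : Fin N} (hij : i ≠ j) {x y : S.Pt}
    (h : S.map i x = S.map j y) : x ∈ S.V 0 := by
  refine mem_iUnion.2 ⟨0, mem_iUnion.2 ⟨fun _ => i, ?_⟩⟩
  exact mem_iUnion.2 ⟨i, mem_iUnion.2 ⟨j, mem_iUnion.2 ⟨hij, ⟨x, rfl⟩, ⟨y, h.symm⟩⟩⟩⟩

/-- Different cells of the same level meet only at images of boundary points: after removing a
common prefix of the two words, the common point is critical. -/
theorem mem_V_zero_of_mapWord_eq : ∀ {n : ℕ} {w w' : Fin n → Fin N}, w ≠ w' →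
    ∀ {x y : S.Pt}, S.mapWord w x = S.mapWord w' y → x ∈ S.V 0
  | 0, w, w', hne, _, _, _ => (hne (Subsingleton.elim _ _)).elim
  | n + 1, w, w', hne, x, y, h => by
    rw [mapWord_succ, mapWord_succ] at h
    by_cases h0 : w 0 = w' 0
    · refine mem_V_zero_of_mapWord_eq (w := Fin.tail w) (w' := Fin.tail w') (fun ht => hne ?_)
        (S.map_injective (w 0) (h.trans (by rw [h0])))
      rw [← Fin.cons_self_tail w, ← Fin.cons_self_tail w', ht, h0]
    · refine mem_iUnion.2 ⟨n, mem_iUnion.2 ⟨w, ?_⟩⟩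
      exact mem_iUnion.2 ⟨w 0, mem_iUnion.2 ⟨w' 0, mem_iUnion.2
        ⟨h0, ⟨_, rfl⟩, ⟨_, h.symm⟩⟩⟩⟩

/-- If `x = F_i y` lies in `V_0` because `F_w x` is critical, then so does `y`, with the word `w`
followed by `i`. -/
theorem V_subset_V_succ : ∀ n, S.V n ⊆ S.V (n + 1)
  | 0 => fun x hx => by
    obtain ⟨n, hx⟩ := mem_iUnion.1 hx
    obtain ⟨w, hx⟩ := mem_iUnion.1 hx
    obtain ⟨i, y, rfl⟩ := S.exists_map_eq x
    refine mem_iUnion.2 ⟨i, y, ?_, rfl⟩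
    refine mem_iUnion.2 ⟨n + 1, mem_iUnion.2 ⟨Fin.snoc w i, ?_⟩⟩
    have key : ∀ (k : ℕ) (v : Fin k → Fin N), S.mapWord (Fin.snoc v i : Fin (k + 1) → Fin N) y =
        S.mapWord v (S.map i y) := by
      intro k
      induction k with
      | zero => intro v; rfl
      | succ k ih =>
        intro v
        rw [← Fin.cons_self_tail v, ← Fin.cons_snoc_eq_snoc_cons, mapWord_cons, mapWord_cons, ih]
    rw [mem_preimage, key]
    exact hx
  | n + 1 => iUnion_mono fun i => image_mono (V_subset_V_succ n)

theorem V_zero_subset (n : ℕ) : S.V 0 ⊆ S.V n :=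
  (monotone_nat_of_le_succ S.V_subset_V_succ) (Nat.zero_le n)

theorem exists_mapWord_eq_of_mem_V : ∀ {n : ℕ} {z : S.Pt}, z ∈ S.V n →
    ∃ (w : Fin n → Fin N), ∃ x ∈ S.V 0, S.mapWord w x = z
  | 0, z, hz => ⟨Fin.elim0, z, hz, rfl⟩
  | n + 1, z, hz => by
    obtain ⟨i, y, hy, rfl⟩ := mem_iUnion.1 hz
    obtain ⟨w, x, hx, rfl⟩ := exists_mapWord_eq_of_mem_V hy
    exact ⟨Fin.cons i w, x, hx, S.mapWord_cons i w x⟩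

theorem mem_V_zero_of_mapWord_mem {n : ℕ} {w : Fin n → Fin N} {x : S.Pt}
    (h : S.mapWord w x ∈ S.V n) : x ∈ S.V 0 := by
  obtain ⟨w', y, hy, hyx⟩ := S.exists_mapWord_eq_of_mem_V h
  by_cases hw : w = w'
  · subst hw
    rwa [← S.mapWord_injective w hyx]
  · exact S.mem_V_zero_of_mapWord_eq hw hyx.symm

instance : CompactSpace S.Pt := isCompact_iff_compactSpace.1 S.isCompact

instance : ConnectedSpace S.Pt := isConnected_iff_connectedSpace.1 S.isConnected

/-- Since `K` is connected, its `1`-cells are linked by chains in which consecutive cells meet. -/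
theorem forall_of_map_eq (P : Fin N → Prop) {i₀ : Fin N} (h₀ : P i₀)
    (h : ∀ i j x y, i ≠ j → S.map i x = S.map j y → P i → P j) (i : Fin N) : P i := by
  by_contra hi
  have hcl : ∀ Q : Fin N → Prop, IsClosed (⋃ j ∈ {j | Q j}, range (S.map j)) := fun Q =>
    (Set.toFinite _).isClosed_biUnion fun j _ => (isCompact_range (S.continuous_map j)).isClosed
  have hpre := isPreconnected_closed_iff.1 (isPreconnected_univ (α := S.Pt)) _ _
    (hcl P) (hcl fun j => ¬ P j)
  obtain ⟨p⟩ : Nonempty S.Pt := inferInstance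
  obtain ⟨z, -, hz1, hz2⟩ := hpre
    (fun x _ => by
      obtain ⟨j, y, rfl⟩ := S.exists_map_eq x
      by_cases hj : P j
      · exact Or.inl (mem_biUnion (x := j) hj ⟨y, rfl⟩)
      · exact Or.inr (mem_biUnion (x := j) hj ⟨y, rfl⟩))
    ⟨S.map i₀ p, trivial, mem_biUnion (x := i₀) h₀ ⟨p, rfl⟩⟩
    ⟨S.map i p, trivial, mem_biUnion (x := i) hi ⟨p, rfl⟩⟩
  obtain ⟨j, hj, x, rfl⟩ := mem_iUnion₂.1 hz1
  obtain ⟨k, hk, y, hxy⟩ := mem_iUnion₂.1 hz2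
  have hj' : P j := hj
  have hk' : ¬ P k := hk
  exact hk' (h j k x y (fun e => hk' (e ▸ hj')) hxy.symm hj')

end SelfSimilarSet

namespace PCFFractal

variable {d N : ℕ} (S : PCFFractal d N)

theorem mem_vert {n : ℕ} {x : S.Pt} : x ∈ S.vert n ↔ x ∈ S.V n :=
  Finite.mem_toFinset _

theorem map_mem_V {n : ℕ} {x : S.Pt} (hx : x ∈ S.V n) (i : Fin N) : S.map i x ∈ S.V (n + 1) :=
  mem_iUnion.2 ⟨i, x, hx, rfl⟩

theorem V_zero_nonempty : (S.V 0).Nonempty := by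
  obtain ⟨x, hx⟩ := S.critical_nonempty
  obtain ⟨i, hx⟩ := mem_iUnion.1 hx
  obtain ⟨j, hx⟩ := mem_iUnion.1 hx
  obtain ⟨hij, ⟨y, hy⟩, ⟨z, hz⟩⟩ := mem_iUnion.1 hx
  exact ⟨y, S.mem_V_zero_of_map_eq hij (hy.trans hz.symm)⟩

end PCFFractal

/-! ### Self-similarity of the conductances -/

namespace HarmonicStructure

variable {d N : ℕ} {S : PCFFractal d N} (H : HarmonicStructure S)

/-- The sum of `g x y` over the ordered pairs of vertices of level `n`, weighted by the
conductances, as a linear form in `g`. -/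
noncomputable def bondSum (n : ℕ) : (S.Pt → S.Pt → ℝ) →ₗ[ℝ] ℝ where
  toFun g := ∑ x ∈ S.vert n, ∑ y ∈ S.vert n, H.c n x y * g x y
  map_add' g h := by simp only [Pi.add_apply, mul_add, Finset.sum_add_distrib]
  map_smul' a g := by
    simp only [Pi.smul_apply, smul_eq_mul, RingHom.id_apply, Finset.mul_sum]
    exact Finset.sum_congr rfl fun x _ => Finset.sum_congr rfl fun y _ => by ring

theorem bondSum_apply (n : ℕ) (g : S.Pt → S.Pt → ℝ) :
    H.bondSum n g = ∑ x ∈ S.vert n, ∑ y ∈ S.vert n, H.c n x y * g x y := rfl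

theorem energy_eq_bondSum (n : ℕ) (u : S.Pt → ℝ) :
    H.energy n u = H.bondSum n fun x y => (u y - u x) ^ 2 / 2 := rfl

theorem bondSum_congr {n : ℕ} {g h : S.Pt → S.Pt → ℝ}
    (hgh : ∀ x ∈ S.V n, ∀ y ∈ S.V n, g x y = h x y) : H.bondSum n g = H.bondSum n h :=
  Finset.sum_congr rfl fun x hx => Finset.sum_congr rfl fun y hy => by
    rw [hgh x (S.mem_vert.1 hx) y (S.mem_vert.1 hy)]

theorem bondSum_swap (n : ℕ) (g : S.Pt → S.Pt → ℝ) :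
    H.bondSum n (fun x y => g y x) = H.bondSum n g := by
  rw [bondSum_apply, Finset.sum_comm]
  exact Finset.sum_congr rfl fun x hx => Finset.sum_congr rfl fun y hy => by
    rw [H.c_symm n y (S.mem_vert.1 hy) x (S.mem_vert.1 hx)]

/-- The self-similarity of the energies, polarised: it holds for the conductances themselves, that
is, with any function of two vertices that vanishes on the diagonal in place of the squared
differences. -/
theorem bondSum_succ (n : ℕ) (g : S.Pt → S.Pt → ℝ) (hg : ∀ x, g x x = 0) :
    H.bondSum (n + 1) g = ∑ i, (H.r i)⁻¹ * H.bondSum n fun x y => g (S.map i x) (S.map i y) := by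
  classical
  let pull (i : Fin N) : (S.Pt → S.Pt → ℝ) →ₗ[ℝ] (S.Pt → S.Pt → ℝ) :=
    { toFun := fun g x y => g (S.map i x) (S.map i y)
      map_add' := fun _ _ => rfl
      map_smul' := fun _ _ => rfl }
  let L : (S.Pt → S.Pt → ℝ) →ₗ[ℝ] ℝ :=
    H.bondSum (n + 1) - ∑ i, (H.r i)⁻¹ • (H.bondSum n ∘ₗ pull i)
  have hL : ∀ g, L g = H.bondSum (n + 1) g -
      ∑ i, (H.r i)⁻¹ * H.bondSum n fun x y => g (S.map i x) (S.map i y) := fun g => by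
    simp [L, pull, LinearMap.sum_apply]
  have hLswap : ∀ g, L (fun x y => g y x) = L g := fun g => by
    rw [hL, hL, bondSum_swap]
    congr 1
    exact Finset.sum_congr rfl fun i _ => by
      rw [← H.bondSum_swap n fun x y => g (S.map i x) (S.map i y)]
  have hLcongr : ∀ g h : S.Pt → S.Pt → ℝ,
      (∀ x ∈ S.V (n + 1), ∀ y ∈ S.V (n + 1), g x y = h x y) → L g = L h := fun g h hgh => by
    rw [hL, hL, H.bondSum_congr hgh]
    congr 1
    exact Finset.sum_congr rfl fun i _ => congrArg _ <| H.bondSum_congr fun x hx y hy =>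
      hgh _ (S.map_mem_V hx i) _ (S.map_mem_V hy i)
  have hLsq : ∀ u : S.Pt → ℝ, L (fun x y => (u y - u x) ^ 2 / 2) = 0 := fun u => by
    rw [hL, sub_eq_zero]
    exact H.energy_succ n u
  let δ (z z' : S.Pt) : S.Pt → S.Pt → ℝ := fun x y => if x = z ∧ y = z' then 1 else 0
  have hLδ : ∀ z z', z ≠ z' → L (δ z z') = 0 := fun z z' hz => by
    let e (z : S.Pt) : S.Pt → ℝ := fun x => if x = z then 1 else 0
    -- Polarisation of the quadratic identity at the indicators of `z` and `z'`.
    have h1 : (δ z z' + fun x y => δ z z' y x) =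
        ((fun x y => (e z y - e z x) ^ 2 / 2) + fun x y => (e z' y - e z' x) ^ 2 / 2) -
          fun x y => ((e z + e z') y - (e z + e z') x) ^ 2 / 2 := by
      funext x y
      simp only [δ, e, Pi.add_apply, Pi.sub_apply]
      grind
    have h2 : L (δ z z') + L (fun x y => δ z z' y x) = 0 := by
      rw [← map_add, h1, map_sub, map_add, hLsq, hLsq, hLsq]
      simp
    have h3 := hLswap (δ z z')
    linarith
  rw [← sub_eq_zero, ← hL]
  have hdecomp : L g = L (∑ z ∈ S.vert (n + 1), ∑ z' ∈ S.vert (n + 1), g z z' • δ z z') := by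
    refine hLcongr _ _ fun x hx y hy => ?_
    simp only [Finset.sum_apply, Pi.smul_apply, smul_eq_mul, δ]
    rw [Finset.sum_eq_single x, Finset.sum_eq_single y]
    · simp
    · intro b _ hb
      simp [hb.symm]
    · exact fun h => (h (S.mem_vert.2 hy)).elim
    · intro b _ hb
      simp [hb.symm]
    · exact fun h => (h (S.mem_vert.2 hx)).elim
  rw [hdecomp]
  simp only [map_sum, map_smul, smul_eq_mul]
  refine Finset.sum_eq_zero fun z _ => Finset.sum_eq_zero fun z' _ => ?_
  by_cases hz : z = z'
  · rw [hz, hg, zero_mul]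
  · rw [hLδ z z' hz, mul_zero]

theorem rWord_pos {n : ℕ} (w : Fin n → Fin N) : 0 < H.rWord w :=
  Finset.prod_pos fun _ _ => H.r_pos _

theorem rWord_cons {n : ℕ} (i : Fin N) (w : Fin n → Fin N) :
    H.rWord (Fin.cons i w : Fin (n + 1) → Fin N) = H.r i * H.rWord w := by
  simp [rWord, Fin.prod_univ_succ]

theorem bondSum_add (k : ℕ) : ∀ (j : ℕ) (g : S.Pt → S.Pt → ℝ), (∀ x, g x x = 0) →
    H.bondSum (k + j) g = ∑ w : Fin j → Fin N,
      (H.rWord w)⁻¹ * H.bondSum k fun x y => g (S.mapWord w x) (S.mapWord w y)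
  | 0, g, _ => by
    simp only [Fintype.sum_unique, rWord, Finset.univ_eq_empty, Finset.prod_empty, inv_one,
      one_mul]
    rfl
  | j + 1, g, hg => by
    rw [← add_assoc, H.bondSum_succ (k + j) g hg,
      ← (Fin.consEquiv fun _ => Fin N).sum_comp, Fintype.sum_prod_type]
    refine Finset.sum_congr rfl fun i _ => ?_
    rw [bondSum_add k j (fun x y => g (S.map i x) (S.map i y)) fun x => hg _, Finset.mul_sum]
    refine Finset.sum_congr rfl fun w _ => ?_
    have e : (Fin.consEquiv fun _ => Fin N) (i, w) = (Fin.cons i w : Fin (j + 1) → Fin N) := rfl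
    rw [e, rWord_cons, mul_inv, mul_assoc]
    simp only [S.mapWord_cons]

theorem energy_add (k j : ℕ) (u : S.Pt → ℝ) :
    H.energy (k + j) u =
      ∑ w : Fin j → Fin N, (H.rWord w)⁻¹ * H.energy k (u ∘ S.mapWord w) :=
  H.bondSum_add k j _ fun x => by simp

theorem energy_nonneg (n : ℕ) (u : S.Pt → ℝ) : 0 ≤ H.energy n u :=
  Finset.sum_nonneg fun x hx => Finset.sum_nonneg fun y hy =>
    mul_nonneg (H.c_nonneg n x (S.mem_vert.1 hx) y (S.mem_vert.1 hy)) (by positivity)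

theorem energy_congr {n : ℕ} {u v : S.Pt → ℝ} (h : EqOn u v (S.V n)) :
    H.energy n u = H.energy n v :=
  H.bondSum_congr fun x hx y hy => by rw [h hx, h hy]

theorem energy_le_succ (n : ℕ) (u : S.Pt → ℝ) : H.energy n u ≤ H.energy (n + 1) u :=
  (H.energy_compatible n u).2 ⟨u, fun _ _ => rfl, rfl⟩

theorem energy_mono (u : S.Pt → ℝ) : Monotone fun n => H.energy n u :=
  monotone_nat_of_le_succ fun n => H.energy_le_succ n u

theorem energy_comp_map_le (n : ℕ) (u : S.Pt → ℝ) (i : Fin N) :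
    H.energy n (u ∘ S.map i) ≤ H.r i * H.energy (n + 1) u := by
  rw [← inv_mul_le_iff₀ (H.r_pos i)]
  refine (Finset.single_le_sum (f := fun i => (H.r i)⁻¹ * H.energy n (u ∘ S.map i))
    (fun j _ => mul_nonneg (inv_nonneg.2 (H.r_pos j).le) (H.energy_nonneg _ _))
    (Finset.mem_univ i)).trans_eq (H.energy_succ n u).symm

theorem energy_comp_mapWord_le {j : ℕ} (k : ℕ) (u : S.Pt → ℝ) (w : Fin j → Fin N) :
    H.energy k (u ∘ S.mapWord w) ≤ H.rWord w * H.energy (k + j) u := by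
  rw [← inv_mul_le_iff₀ (H.rWord_pos w), energy_add]
  exact Finset.single_le_sum
    (f := fun w : Fin j → Fin N => (H.rWord w)⁻¹ * H.energy k (u ∘ S.mapWord w))
    (fun v _ => mul_nonneg (inv_nonneg.2 (H.rWord_pos v).le) (H.energy_nonneg _ _))
    (Finset.mem_univ w)

/-- The resistance scalings are bounded by a common `q < 1`. -/
theorem exists_r_le : ∃ q : ℝ, 0 < q ∧ q < 1 ∧ ∀ i, H.r i ≤ q := by
  have h : ∃ q : ℝ, q < 1 ∧ ∀ i, H.r i ≤ q := by
    rcases isEmpty_or_nonempty (Fin N) with hN | hN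
    · exact ⟨0, one_pos, fun i => hN.elim i⟩
    · obtain ⟨i, hi⟩ := Finite.exists_max H.r
      exact ⟨H.r i, H.r_lt_one i, hi⟩
  obtain ⟨q, hq, hr⟩ := h
  exact ⟨max q (1 / 2), by positivity, max_lt hq (by norm_num), fun i => (hr i).trans
    (le_max_left _ _)⟩

/-! ### Oscillation is controlled by energy -/

/-- The effective resistance between `x` and `y` in the network of level `n` is finite: the
difference of the values at `x` and `y` is controlled by the energy. -/
def FiniteResistance (n : ℕ) (x y : S.Pt) : Prop :=
  ∃ C : ℝ, ∀ u : S.Pt → ℝ, |u y - u x| ≤ C * √(H.energy n u)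

namespace FiniteResistance

variable {H} {n : ℕ} {x y z : S.Pt}

theorem refl (H : HarmonicStructure S) (n : ℕ) (x : S.Pt) : H.FiniteResistance n x x :=
  ⟨0, fun u => by simp⟩

theorem symm (h : H.FiniteResistance n x y) : H.FiniteResistance n y x := by
  obtain ⟨C, hC⟩ := h
  exact ⟨C, fun u => by rw [abs_sub_comm]; exact hC u⟩

theorem trans (h : H.FiniteResistance n x y) (k : H.FiniteResistance n y z) :
    H.FiniteResistance n x z := by
  obtain ⟨C, hC⟩ := h
  obtain ⟨C', hC'⟩ := k
  refine ⟨C' + C, fun u => ?_⟩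
  rw [add_mul]
  exact (abs_sub_le _ _ _).trans (add_le_add (hC' u) (hC u))

theorem of_conductance (hx : x ∈ S.V n) (hy : y ∈ S.V n) (hc : 0 < H.c n x y) :
    H.FiniteResistance n x y := by
  refine ⟨√(2 / H.c n x y), fun u => ?_⟩
  rw [← Real.sqrt_mul (by positivity), ← Real.sqrt_sq_eq_abs]
  refine Real.sqrt_le_sqrt ?_
  have h0 : ∀ a ∈ S.vert n, ∀ b ∈ S.vert n, 0 ≤ H.c n a b * ((u b - u a) ^ 2 / 2) :=
    fun a ha b hb => mul_nonneg (H.c_nonneg n a (S.mem_vert.1 ha) b (S.mem_vert.1 hb))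
      (by positivity)
  have h1 : H.c n x y * ((u y - u x) ^ 2 / 2) ≤ H.energy n u :=
    (Finset.single_le_sum (h0 x (S.mem_vert.2 hx)) (S.mem_vert.2 hy)).trans
      (Finset.single_le_sum (f := fun x => ∑ y ∈ S.vert n, H.c n x y * ((u y - u x) ^ 2 / 2))
        (fun a ha => Finset.sum_nonneg (h0 a ha)) (S.mem_vert.2 hx))
  rw [div_mul_eq_mul_div, le_div_iff₀ hc]
  linarith

theorem exists_nonneg (h : H.FiniteResistance n x y) :
    ∃ C : ℝ, 0 ≤ C ∧ ∀ u : S.Pt → ℝ, |u y - u x| ≤ C * √(H.energy n u) := by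
  obtain ⟨C, hC⟩ := h
  exact ⟨|C|, abs_nonneg C, fun u => (hC u).trans
    (mul_le_mul_of_nonneg_right (le_abs_self C) (Real.sqrt_nonneg _))⟩

end FiniteResistance

/-- The indicator of the points at finite resistance from `x` has energy zero, hence is constant
on the boundary. -/
theorem finiteResistance_zero {x y : S.Pt} (hx : x ∈ S.V 0) (hy : y ∈ S.V 0) :
    H.FiniteResistance 0 x y := by
  classical
  let u : S.Pt → ℝ := fun z => if H.FiniteResistance 0 x z then 1 else 0
  have hu : H.energy 0 u = 0 := by
    refine Finset.sum_eq_zero fun a ha => Finset.sum_eq_zero fun b hb => ?_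
    rw [S.mem_vert] at ha hb
    rcases (H.c_nonneg 0 a ha b hb).eq_or_lt with h | h
    · rw [← h, zero_mul]
    · have hab := FiniteResistance.of_conductance ha hb h
      have : u b = u a := by
        simp only [u]
        congr 1
        exact propext ⟨fun k => k.trans hab.symm, fun k => k.trans hab⟩
      rw [this]
      simp
  have h := H.irreducible u hu x hx y hy
  by_contra hxy
  simp [u, hxy, FiniteResistance.refl] at h

theorem FiniteResistance.map {n : ℕ} {x y : S.Pt} (h : H.FiniteResistance n x y) (i : Fin N) :
    H.FiniteResistance (n + 1) (S.map i x) (S.map i y) := by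
  obtain ⟨C, hC0, hC⟩ := h.exists_nonneg
  refine ⟨C, fun u => (hC (u ∘ S.map i)).trans (mul_le_mul_of_nonneg_left ?_ hC0)⟩
  refine Real.sqrt_le_sqrt ((H.energy_comp_map_le n u i).trans ?_)
  exact mul_le_of_le_one_left (H.energy_nonneg _ _) (H.r_lt_one i).le

theorem finiteResistance_one {x y : S.Pt} (hx : x ∈ S.V 1) (hy : y ∈ S.V 1) :
    H.FiniteResistance 1 x y := by
  obtain ⟨i, a, ha, rfl⟩ := mem_iUnion.1 hx
  obtain ⟨j, b, hb, rfl⟩ := mem_iUnion.1 hy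
  refine S.forall_of_map_eq
    (fun j => ∀ b ∈ S.V 0, H.FiniteResistance 1 (S.map i a) (S.map j b)) (i₀ := i)
    (fun b hb => (H.finiteResistance_zero ha hb).map H i) ?_ j b hb
  intro j k x y hjk hxy hj b hb
  refine (hj x (S.mem_V_zero_of_map_eq hjk hxy)).trans ?_
  rw [hxy]
  exact (H.finiteResistance_zero (S.mem_V_zero_of_map_eq hjk.symm hxy.symm) hb).map H k

/-- A bound uniform in the pair of vertices. -/
theorem exists_abs_sub_le_of_finiteResistance {n : ℕ}
    (h : ∀ x ∈ S.V n, ∀ y ∈ S.V n, H.FiniteResistance n x y) :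
    ∃ C : ℝ, 0 ≤ C ∧ ∀ (u : S.Pt → ℝ), ∀ x ∈ S.V n, ∀ y ∈ S.V n,
      |u y - u x| ≤ C * √(H.energy n u) := by
  choose! C hC using fun x hx y hy => (h x hx y hy).exists_nonneg
  have hsum0 : ∀ x ∈ S.vert n, 0 ≤ ∑ y ∈ S.vert n, C x y := fun x hx =>
    Finset.sum_nonneg fun y hy => (hC x (S.mem_vert.1 hx) y (S.mem_vert.1 hy)).1
  refine ⟨∑ x ∈ S.vert n, ∑ y ∈ S.vert n, C x y, Finset.sum_nonneg hsum0, fun u x hx y hy => ?_⟩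
  refine ((hC x hx y hy).2 u).trans (mul_le_mul_of_nonneg_right ?_ (Real.sqrt_nonneg _))
  exact (Finset.single_le_sum (f := fun y => C x y)
    (fun z hz => (hC x hx z (S.mem_vert.1 hz)).1) (S.mem_vert.2 hy)).trans
    (Finset.single_le_sum (f := fun x => ∑ y ∈ S.vert n, C x y) hsum0 (S.mem_vert.2 hx))

end HarmonicStructure

/-! ### Continuous harmonic extension of boundary values -/

namespace HarmonicStructure

variable {d N : ℕ} {S : PCFFractal d N} (H : HarmonicStructure S)

/-- An extension of the boundary values `φ` to `V_1` of least energy. Only its values on `V_1` are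
meaningful. -/
noncomputable def discreteExtension (φ : S.Pt → ℝ) : S.Pt → ℝ :=
  (H.energy_compatible 0 φ).1.choose

theorem discreteExtension_eqOn (φ : S.Pt → ℝ) : EqOn (H.discreteExtension φ) φ (S.V 0) :=
  (H.energy_compatible 0 φ).1.choose_spec.1

theorem energy_one_discreteExtension (φ : S.Pt → ℝ) :
    H.energy 1 (H.discreteExtension φ) = H.energy 0 φ :=
  (H.energy_compatible 0 φ).1.choose_spec.2

theorem sqrt_energy_discreteExtension_comp_le {q : ℝ} (hq0 : 0 ≤ q) (hq : ∀ i, H.r i ≤ q)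
    (φ : S.Pt → ℝ) (i : Fin N) :
    √(H.energy 0 (H.discreteExtension φ ∘ S.map i)) ≤ √q * √(H.energy 0 φ) := by
  rw [← Real.sqrt_mul hq0]
  refine Real.sqrt_le_sqrt ((H.energy_comp_map_le 0 _ i).trans ?_)
  rw [zero_add, energy_one_discreteExtension]
  exact mul_le_mul_of_nonneg_right (hq i) (H.energy_nonneg _ _)

/-- Continuous, not necessarily harmonic, extension of boundary values with controlled
oscillation. -/
theorem exists_continuous_extension {x₀ : S.Pt} (hx₀ : x₀ ∈ S.V 0) {C : ℝ} (hC0 : 0 ≤ C)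
    (hC : ∀ (u : S.Pt → ℝ), ∀ x ∈ S.V 0, ∀ y ∈ S.V 0, |u y - u x| ≤ C * √(H.energy 0 u))
    (φ : S.Pt → ℝ) :
    ∃ g : C(S.Pt, ℝ), EqOn g φ (S.V 0) ∧ ∀ x, |g x - φ x₀| ≤ C * √(H.energy 0 φ) := by
  have hfin : Finite (S.V 0) := (S.V_finite 0).to_subtype
  obtain ⟨g, hg, hgφ⟩ := ContinuousMap.exists_restrict_eq_forall_mem_of_closed
    (s := S.V 0) ⟨fun x => φ x, continuous_of_discreteTopology⟩
    (t := Icc (φ x₀ - C * √(H.energy 0 φ)) (φ x₀ + C * √(H.energy 0 φ)))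
    (fun x => by
      rw [← Real.closedBall_eq_Icc, Metric.mem_closedBall, Real.dist_eq]
      exact hC φ x₀ hx₀ x x.2)
    (by
      rw [← Real.closedBall_eq_Icc]
      exact ⟨φ x₀, Metric.mem_closedBall_self (by positivity)⟩) (S.V_finite 0).isClosed
  refine ⟨g, fun x hx => DFunLike.congr_fun hgφ ⟨x, hx⟩, fun x => ?_⟩
  rw [← Real.dist_eq, ← Metric.mem_closedBall, Real.closedBall_eq_Icc]
  exact hg x

/-- Given a way `Φ` of extending boundary values continuously to `K`, extend them discretely to
`V_1` first and then by `Φ` inside each `1`-cell. -/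
theorem exists_refined_extension (Φ : (S.Pt → ℝ) → C(S.Pt, ℝ))
    (hΦ : ∀ φ, EqOn (Φ φ) φ (S.V 0)) :
    ∃ Φ' : (S.Pt → ℝ) → C(S.Pt, ℝ), (∀ φ, EqOn (Φ' φ) φ (S.V 0)) ∧
      ∀ φ i x, Φ' φ (S.map i x) = Φ (H.discreteExtension φ ∘ S.map i) x := by
  choose Φ' hΦ' using fun φ => ContinuousMap.exists_of_finite_cover (fun i => S.map i)
    S.continuous_map S.exists_map_eq (fun i x => Φ (H.discreteExtension φ ∘ S.map i) x)
    (fun i => (Φ _).continuous) (fun i j x y h => by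
      by_cases hij : i = j
      · subst hij
        rw [S.map_injective i h]
      · rw [hΦ _ (S.mem_V_zero_of_map_eq hij h), hΦ _ (S.mem_V_zero_of_map_eq (Ne.symm hij) h.symm),
          Function.comp_apply, Function.comp_apply, h])
  refine ⟨Φ', fun φ x hx => ?_, hΦ'⟩
  obtain ⟨i, y, hy, rfl⟩ := mem_iUnion.1 (S.V_subset_V_succ 0 hx)
  rw [hΦ', hΦ _ hy, Function.comp_apply, H.discreteExtension_eqOn φ hx]

/-- Boundary values extend to continuous functions whose energy is that of the boundary values on
every level. The extension is the limit of successive refinements; the energies of the discrete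
extension on the `1`-cells decrease by the factors `r i < 1`, and they control oscillations, so
the refinements converge geometrically. -/
theorem exists_harmonic_extension : ∃ Φ : (S.Pt → ℝ) → C(S.Pt, ℝ),
    (∀ φ, EqOn (Φ φ) φ (S.V 0)) ∧ ∀ n φ, H.energy n (Φ φ) = H.energy 0 φ := by
  obtain ⟨x₀, hx₀⟩ := S.V_zero_nonempty
  obtain ⟨q, hq0, hq1, hq⟩ := H.exists_r_le
  obtain ⟨C₀, hC₀0, hC₀⟩ := H.exists_abs_sub_le_of_finiteResistance (n := 0)
    fun x hx y hy => H.finiteResistance_zero hx hy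
  obtain ⟨C₁, hC₁0, hC₁⟩ := H.exists_abs_sub_le_of_finiteResistance (n := 1)
    fun x hx y hy => H.finiteResistance_one hx hy
  choose Φ₀ hΦ₀ hΦ₀osc using H.exists_continuous_extension hx₀ hC₀0 hC₀
  choose T hT hTmap using H.exists_refined_extension
  obtain ⟨seq, hseq0, hseq⟩ : ∃ seq : ℕ → {Φ : (S.Pt → ℝ) → C(S.Pt, ℝ) //
      ∀ φ, EqOn (Φ φ) φ (S.V 0)}, (seq 0).1 = Φ₀ ∧ ∀ n φ i x, (seq (n + 1)).1 φ (S.map i x) =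
        (seq n).1 (H.discreteExtension φ ∘ S.map i) x :=
    ⟨fun n => Nat.rec ⟨Φ₀, hΦ₀⟩ (fun _ Φ => ⟨T Φ.1 Φ.2, hT Φ.1 Φ.2⟩) n, rfl,
      fun n => hTmap _ _⟩
  have hq1' : √q < 1 := by
    rw [Real.sqrt_lt' one_pos, one_pow]
    exact hq1
  have hstep : ∀ n φ x, |(seq n).1 φ x - (seq (n + 1)).1 φ x| ≤
      (C₀ + C₁ + C₀) * √q ^ n * √(H.energy 0 φ) := by
    intro n
    induction n with
    | zero =>
      intro φ x
      obtain ⟨i, y, rfl⟩ := S.exists_map_eq x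
      rw [hseq, hseq0, pow_zero, mul_one]
      set ψ := H.discreteExtension φ ∘ S.map i with hψ
      have h1 : |Φ₀ φ (S.map i y) - φ x₀| ≤ C₀ * √(H.energy 0 φ) := hΦ₀osc φ _
      have h2 : |φ x₀ - ψ x₀| ≤ C₁ * √(H.energy 0 φ) := by
        rw [← H.discreteExtension_eqOn φ hx₀, ← energy_one_discreteExtension]
        exact hC₁ _ _ (S.map_mem_V hx₀ i) _ (S.V_subset_V_succ 0 hx₀)
      have h3 : |ψ x₀ - Φ₀ ψ y| ≤ C₀ * √(H.energy 0 φ) := by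
        rw [abs_sub_comm]
        refine (hΦ₀osc ψ y).trans (mul_le_mul_of_nonneg_left ?_ hC₀0)
        exact (H.sqrt_energy_discreteExtension_comp_le hq0.le hq φ i).trans
          (mul_le_of_le_one_left (Real.sqrt_nonneg _) hq1'.le)
      have h4 := abs_sub_le (Φ₀ φ (S.map i y)) (φ x₀) (Φ₀ ψ y)
      have h5 := abs_sub_le (φ x₀) (ψ x₀) (Φ₀ ψ y)
      rw [add_mul, add_mul]
      linarith
    | succ n ih =>
      intro φ x
      obtain ⟨i, y, rfl⟩ := S.exists_map_eq x
      rw [hseq, hseq (n + 1)]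
      refine (ih _ y).trans ?_
      rw [pow_succ, ← mul_assoc, mul_assoc (_ * _) (√q)]
      exact mul_le_mul_of_nonneg_left
        (H.sqrt_energy_discreteExtension_comp_le hq0.le hq φ i) (by positivity)
  have hlim : ∀ φ, ∃ g : C(S.Pt, ℝ), Tendsto (fun n => (seq n).1 φ) atTop (𝓝 g) := fun φ => by
    refine cauchySeq_tendsto_of_complete
      (cauchySeq_of_le_geometric (√q) ((C₀ + C₁ + C₀) * √(H.energy 0 φ)) hq1' fun n => ?_)
    refine (ContinuousMap.dist_le (by positivity)).2 fun x => ?_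
    rw [Real.dist_eq, mul_right_comm]
    exact hstep n φ x
  choose Φ hΦ using hlim
  have hpt : ∀ φ x, Tendsto (fun n => (seq n).1 φ x) atTop (𝓝 (Φ φ x)) := fun φ x =>
    ((continuous_eval_const x).tendsto _).comp (hΦ φ)
  have hΦV : ∀ φ, EqOn (Φ φ) φ (S.V 0) := fun φ x hx =>
    tendsto_nhds_unique (hpt φ x) (by
      simp only [fun n => (seq n).2 φ hx]
      exact tendsto_const_nhds)
  have hΦmap : ∀ φ i, Φ φ ∘ S.map i = Φ (H.discreteExtension φ ∘ S.map i) := fun φ i =>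
    funext fun x => tendsto_nhds_unique ((hpt φ (S.map i x)).comp (tendsto_add_atTop_nat 1)) (by
      simp only [Function.comp_def, hseq]
      exact hpt _ x)
  refine ⟨Φ, hΦV, fun n => ?_⟩
  induction n with
  | zero => exact fun φ => H.energy_congr (hΦV φ)
  | succ n ih =>
    intro φ
    refine (H.energy_succ n (Φ φ)).trans ?_
    simp only [hΦmap]
    rw [← energy_one_discreteExtension]
    refine Eq.trans ?_ (H.energy_succ 0 (H.discreteExtension φ)).symm
    exact Finset.sum_congr rfl fun i _ => congrArg _ (ih _)

end HarmonicStructure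

/-! ### The cut space -/

namespace HarmonicStructure.CutData

variable {d N : ℕ} {S : PCFFractal d N} {H : HarmonicStructure S} {m n : ℕ} (D : H.CutData m n)

theorem pt_eq_pt_iff {w w' : Fin (m + 1) → Fin N} {x x' : S.Pt} :
    D.pt w x = D.pt w' x' ↔ S.mapWord w x = S.mapWord w' x' ∧
      ∀ i, S.mapWord w x = D.cut i → (w ∈ D.plus i ↔ w' ∈ D.plus i) :=
  Quotient.eq (r := D.domSetoid)

theorem exists_pt (p : D.FundDomain) : ∃ w x, D.pt w x = p := by
  induction p using Quotient.inductionOn with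
  | h p => exact ⟨p.1, p.2, rfl⟩

theorem proj_pt (w : Fin (m + 1) → Fin N) (x : S.Pt) : D.proj (D.pt w x) = S.mapWord w x := rfl

theorem continuous_pt (w : Fin (m + 1) → Fin N) : Continuous (D.pt w) :=
  continuous_quotient_mk'.comp (Continuous.prodMk_right w)

/-- Functions on the cells that respect the gluing descend to `K⁰`. -/
theorem exists_continuousMap_of_pt (g : (Fin (m + 1) → Fin N) → C(S.Pt, ℝ))
    (hg : ∀ w w' x x', D.pt w x = D.pt w' x' → g w x = g w' x') :
    ∃ u : C(D.FundDomain, ℝ), ∀ w x, u (D.pt w x) = g w x := by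
  refine ⟨⟨Quotient.lift (fun p => g p.1 p.2) fun p q h => hg _ _ _ _ (Quotient.sound h),
    Continuous.quotient_lift ?_ _⟩, fun w x => rfl⟩
  exact continuous_prod_of_discrete_left.2 fun w => (g w).continuous

theorem cut_injective : Function.Injective D.cut := fun i j h => by
  by_contra hij
  exact D.cut_notMem i j (Ne.symm hij) (by rw [h]; exact (D.ι j).start_mem_support)

theorem length_pos (i : Fin n) : 0 < (D.ι i).length :=
  lt_of_lt_of_le (by norm_num) (D.ι_isCycle i).three_le_length

theorem cut_mem_V (i : Fin n) : D.cut i ∈ S.V (m + 1) := by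
  have h := (D.ι i).adj_getVert_succ (D.length_pos i)
  rw [SimpleGraph.Walk.getVert_zero] at h
  exact h.2.1

variable {D} in
theorem IsPlusCopy.proj_eq {i : Fin n} {p : D.FundDomain} (h : D.IsPlusCopy i p) :
    D.proj p = D.cut i := by
  obtain ⟨w, -, x, hx, rfl⟩ := h
  exact hx

variable {D} in
theorem IsMinusCopy.proj_eq {i : Fin n} {p : D.FundDomain} (h : D.IsMinusCopy i p) :
    D.proj p = D.cut i := by
  obtain ⟨w, -, x, hx, rfl⟩ := h
  exact hx

variable {D} in
theorem IsPlusCopy.not_isMinusCopy {i : Fin n} {p : D.FundDomain} (h : D.IsPlusCopy i p) :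
    ¬ D.IsMinusCopy i p := by
  rintro ⟨w', hw', x', -, h'⟩
  obtain ⟨w, hw, x, hx, rfl⟩ := h
  exact hw' ((((D.pt_eq_pt_iff).1 h').2 i hx).1 hw)

/-- Points of `K⁰` over the same point of `K` differ only at a cut vertex. -/
theorem eq_or_copies_of_proj_eq {p q : D.FundDomain} (h : D.proj p = D.proj q) :
    p = q ∨ ∃ i, (D.IsPlusCopy i p ∧ D.IsMinusCopy i q) ∨
      (D.IsMinusCopy i p ∧ D.IsPlusCopy i q) := by
  obtain ⟨w, x, rfl⟩ := D.exists_pt p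
  obtain ⟨w', x', rfl⟩ := D.exists_pt q
  rw [or_iff_not_imp_left, D.pt_eq_pt_iff, not_and]
  intro hne
  have h' := hne h
  push Not at h'
  obtain ⟨i, hi, h'⟩ := h'
  have hi' : S.mapWord w' x' = D.cut i := Eq.trans h.symm hi
  rcases h' with ⟨h1, h2⟩ | ⟨h1, h2⟩
  · exact ⟨i, Or.inl ⟨⟨w, h1, x, hi, rfl⟩, ⟨w', h2, x', hi', rfl⟩⟩⟩
  · exact ⟨i, Or.inr ⟨⟨w, h1, x, hi, rfl⟩, ⟨w', h2, x', hi', rfl⟩⟩⟩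

theorem exists_admissible (ρ : Fin n → ℤ) (b : D.FundDomain) : ∃ u, D.Admissible ρ b u := by
  classical
  let v : D.FundDomain → ℝ := fun p => ∑ i, if D.IsPlusCopy i p then (ρ i : ℝ) else 0
  have hv : ∀ i p, D.proj p = D.cut i → v p = if D.IsPlusCopy i p then (ρ i : ℝ) else 0 :=
    fun i p hp => Finset.sum_eq_single i (fun j _ hj => if_neg fun hjp =>
      hj (D.cut_injective (hjp.proj_eq.symm.trans hp))) fun h => (h (Finset.mem_univ i)).elim
  refine ⟨fun p => v p - v b, sub_self _, fun i p q hp hq => ?_⟩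
  have hq' : ¬ D.IsPlusCopy i q := fun h => h.not_isMinusCopy hq
  simp only [hv i p hp.proj_eq, hv i q hq.proj_eq, if_pos hp, if_neg hq']
  ring

variable {D} in
/-- Admissible functions may be varied along functions on `K`, normalised at the reference
point. -/
theorem Admissible.add_comp_proj {ρ : Fin n → ℤ} {b : D.FundDomain} {u : D.FundDomain → ℝ}
    (hu : D.Admissible ρ b u) (η : S.Pt → ℝ) (t : ℝ) :
    D.Admissible ρ b fun p => u p + t * (η (D.proj p) - η (D.proj b)) := by
  refine ⟨by simp [hu.1], fun i p q hp hq => ?_⟩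
  simp only [hu.2 i p q hp hq, hp.proj_eq, hq.proj_eq]
  ring

/-! ### The energy minimiser -/

theorem domEnergy_zero_le (k : ℕ) (u : D.FundDomain → ℝ) : D.domEnergy 0 u ≤ D.domEnergy k u :=
  Finset.sum_le_sum fun w _ =>
    mul_le_mul_of_nonneg_left (H.energy_mono _ (Nat.zero_le k)) (inv_nonneg.2 (H.rWord_pos w).le)

/-- The energy of the coarsest level is the square of the norm of a linear map into a Euclidean
space, one coordinate for each ordered pair of boundary points of each cell. -/
theorem exists_norm_sq_eq_domEnergy_zero :
    ∃ T : (D.FundDomain → ℝ) →ₗ[ℝ]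
        EuclideanSpace ℝ ((Fin (m + 1) → Fin N) × S.vert 0 × S.vert 0),
      ∀ u, ‖T u‖ ^ 2 = D.domEnergy 0 u := by
  let T : (D.FundDomain → ℝ) →ₗ[ℝ]
      EuclideanSpace ℝ ((Fin (m + 1) → Fin N) × S.vert 0 × S.vert 0) :=
    { toFun := fun u => WithLp.toLp 2 fun e =>
        √((H.rWord e.1)⁻¹ * (H.c 0 e.2.1 e.2.2 / 2)) *
          (u (D.pt e.1 e.2.2) - u (D.pt e.1 e.2.1))
      map_add' := fun u v => by
        ext e
        simp only [Pi.add_apply, PiLp.add_apply]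
        ring
      map_smul' := fun a u => by
        ext e
        simp only [Pi.smul_apply, PiLp.smul_apply, smul_eq_mul, RingHom.id_apply]
        ring }
  refine ⟨T, fun u => ?_⟩
  have hsq : ∀ (w : Fin (m + 1) → Fin N) (x y : S.vert 0), ‖T u (w, x, y)‖ ^ 2 =
      (H.rWord w)⁻¹ * (H.c 0 x y * ((u (D.pt w y) - u (D.pt w x)) ^ 2 / 2)) := fun w x y => by
    have hc := H.c_nonneg 0 x (S.mem_vert.1 x.2) y (S.mem_vert.1 y.2)
    have hr := (H.rWord_pos w).le
    change ‖√((H.rWord w)⁻¹ * (H.c 0 x y / 2)) * (u (D.pt w y) - u (D.pt w x))‖ ^ 2 = _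
    rw [Real.norm_eq_abs, sq_abs, mul_pow, Real.sq_sqrt (by positivity)]
    ring
  rw [EuclideanSpace.norm_sq_eq, Fintype.sum_prod_type]
  refine Finset.sum_congr rfl fun w _ => ?_
  rw [Fintype.sum_prod_type]
  simp only [hsq, ← Finset.mul_sum]
  congr 1
  rw [energy_eq_bondSum, bondSum_apply, ← Finset.sum_coe_sort (S.vert 0)]
  refine Finset.sum_congr rfl fun x _ => ?_
  rw [← Finset.sum_coe_sort (S.vert 0)]

/-- On the coarsest level the energy attains its minimum among the admissible functions: a
finite-dimensional affine subspace of a Euclidean space has a point of least norm. -/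
theorem exists_minimizer_domEnergy_zero (ρ : Fin n → ℤ) (b : D.FundDomain) :
    ∃ u, D.Admissible ρ b u ∧ ∀ v, D.Admissible ρ b v → D.domEnergy 0 u ≤ D.domEnergy 0 v := by
  obtain ⟨T, hT⟩ := D.exists_norm_sq_eq_domEnergy_zero
  obtain ⟨a, ha⟩ := D.exists_admissible ρ b
  let W : Submodule ℝ (D.FundDomain → ℝ) :=
    { carrier := {u | u b = 0 ∧ ∀ i p q, D.IsPlusCopy i p → D.IsMinusCopy i q → u p = u q}
      zero_mem' := ⟨rfl, fun _ _ _ _ _ => rfl⟩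
      add_mem' := fun {u v} hu hv => ⟨by simp [hu.1, hv.1], fun i p q hp hq => by
        simp [hu.2 i p q hp hq, hv.2 i p q hp hq]⟩
      smul_mem' := fun t u hu => ⟨by simp [hu.1], fun i p q hp hq => by
        simp [hu.2 i p q hp hq]⟩ }
  obtain ⟨z, hz, hmin⟩ := (W.map T).exists_norm_eq_iInf_of_complete_subspace
    (Submodule.complete_of_finiteDimensional _) (T a)
  obtain ⟨h, hh, rfl⟩ := hz
  refine ⟨a - h, ⟨by simp [ha.1, hh.1], fun i p q hp hq => ?_⟩, fun v hv => ?_⟩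
  · simp only [Pi.sub_apply, ha.2 i p q hp hq, hh.2 i p q hp hq]
    ring
  · have hav : a - v ∈ W := ⟨by simp [ha.1, hv.1], fun i p q hp hq => by
      simp only [Pi.sub_apply, ha.2 i p q hp hq, hv.2 i p q hp hq]
      ring⟩
    have hle : ‖T a - T h‖ ≤ ‖T a - T (a - v)‖ := by
      rw [hmin]
      exact ciInf_le_of_le ⟨0, by rintro _ ⟨w, rfl⟩; exact norm_nonneg _⟩
        ⟨T (a - v), Submodule.mem_map_of_mem hav⟩ le_rfl
    rw [← map_sub, ← map_sub, sub_sub_cancel] at hle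
    rw [← hT, ← hT]
    exact pow_le_pow_left₀ (norm_nonneg _) hle 2

/-- Harmonic extension into the cells turns the minimiser of the coarsest level into one of all
levels: its energy does not grow with the level, while that of other functions does not
decrease. -/
theorem exists_isEnergyMinimizer (ρ : Fin n → ℤ) (b : D.FundDomain) (hb : D.proj b ∈ S.V 0) :
    ∃ u : C(D.FundDomain, ℝ), D.IsEnergyMinimizer ρ b u := by
  obtain ⟨u₀, hu₀, hmin⟩ := D.exists_minimizer_domEnergy_zero ρ b
  obtain ⟨Φ, hΦ, hΦE⟩ := H.exists_harmonic_extension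
  obtain ⟨u, hu⟩ := D.exists_continuousMap_of_pt (fun w => Φ fun x => u₀ (D.pt w x))
    (fun w w' x x' h => by
      have hxx := (D.pt_eq_pt_iff.1 h).1
      by_cases hw : w = w'
      · subst hw
        rw [S.mapWord_injective w hxx]
      · rw [hΦ _ (S.mem_V_zero_of_mapWord_eq hw hxx),
          hΦ _ (S.mem_V_zero_of_mapWord_eq (Ne.symm hw) hxx.symm), h])
  have huV : ∀ p, D.proj p ∈ S.V (m + 1) → u p = u₀ p := fun p hp => by
    obtain ⟨w, x, rfl⟩ := D.exists_pt p
    rw [hu, hΦ _ (S.mem_V_zero_of_mapWord_mem hp)]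
  have hE : ∀ k, D.domEnergy k u = D.domEnergy 0 u₀ := fun k =>
    Finset.sum_congr rfl fun w _ => by
      simp only [hu]
      rw [← hΦE k fun x => u₀ (D.pt w x)]
  have hle : ∀ (k : ℕ) (v : D.FundDomain → ℝ), D.Admissible ρ b v →
      D.domEnergy k u ≤ D.domEnergy k v := fun k v hv =>
    (hE k).trans_le ((hmin v hv).trans (D.domEnergy_zero_le k v))
  refine ⟨u, ⟨?_, fun i p q hp hq => ?_⟩, ?_, fun v hv => ?_, hle⟩
  · rw [huV b (S.V_zero_subset _ hb), hu₀.1]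
  · rw [huV p (hp.proj_eq ▸ D.cut_mem_V i), huV q (hq.proj_eq ▸ D.cut_mem_V i)]
    exact hu₀.2 i p q hp hq
  · simp only [limEnergy, hE, ciSup_const]
    exact ENNReal.ofReal_lt_top
  · exact iSup_mono fun k => ENNReal.ofReal_le_ofReal (hle k v hv)

/-! ### Descent to the circle and lift to the covering space -/

variable {D} in
theorem Admissible.exists_circleMap {ρ : Fin n → ℤ} {b : D.FundDomain} {u : C(D.FundDomain, ℝ)}
    (hu : D.Admissible ρ b u) : ∃ f : C(S.Pt, Circ), ∀ p, f (D.proj p) = ((u p : ℝ) : Circ) := by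
  have hint : ∀ k : ℤ, (((k : ℝ) : ℝ) : Circ) = 0 := fun k => by
    have := AddCircle.coe_eq_zero_iff (1 : ℝ) (x := (k : ℝ))
    exact this.2 ⟨k, by simp⟩
  obtain ⟨f, hf⟩ := ContinuousMap.exists_of_finite_cover
    (fun w : Fin (m + 1) → Fin N => S.mapWord w) S.continuous_mapWord (S.exists_mapWord_eq _)
    (fun w x => ((u (D.pt w x) : ℝ) : Circ))
    (fun w => (AddCircle.continuous_mk' 1).comp (u.continuous.comp (D.continuous_pt w)))
    (fun w w' x x' h => by
      rcases D.eq_or_copies_of_proj_eq (p := D.pt w x) (q := D.pt w' x') h with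
        h | ⟨i, ⟨h1, h2⟩ | ⟨h1, h2⟩⟩
      · rw [h]
      · rw [hu.2 i _ _ h1 h2, AddCircle.coe_add, hint, add_zero]
      · rw [hu.2 i _ _ h2 h1, AddCircle.coe_add, hint, add_zero])
  refine ⟨f, fun p => ?_⟩
  obtain ⟨w, x, rfl⟩ := D.exists_pt p
  exact hf w x

variable {D} in
theorem Admissible.exists_coveringMap {ρ : Fin n → ℤ} {b : D.FundDomain} {u : C(D.FundDomain, ℝ)}
    (hu : D.Admissible ρ b u) :
    ∃ U : C(D.CoveringSpace ρ, ℝ), ∀ s p, U (D.sheet ρ s p) = u p + s := by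
  refine ⟨⟨Quot.lift (fun p => u p.1 + p.2) ?_, continuous_quot_lift _ ?_⟩, fun s p => rfl⟩
  · rintro ⟨p, s⟩ ⟨q, t⟩ ⟨i, hp, hq, hst⟩
    simp only at hp hq hst
    simp only [hu.2 i p q hp hq, hst, Int.cast_add]
    ring
  · exact (u.continuous.comp continuous_fst).add
      (continuous_of_discreteTopology.comp continuous_snd)

end HarmonicStructure.CutData

/-! ### Degrees along the loops -/

theorem circ_coe_eq_coe_iff {x y : ℝ} : (x : Circ) = (y : Circ) ↔ ∃ k : ℤ, (k : ℝ) = x - y := by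
  rw [← sub_eq_zero, ← AddCircle.coe_sub, AddCircle.coe_eq_zero_iff]
  simp

/-- Two lifts of the same circle-valued path have the same increment. -/
theorem sub_eq_sub_of_coe_eq {a b : ℝ} (hab : a ≤ b) {G h : ℝ → ℝ} (hG : ContinuousOn G (Icc a b))
    (hh : ContinuousOn h (Icc a b)) (hGh : ∀ t ∈ Icc a b, (G t : Circ) = (h t : Circ)) :
    G b - G a = h b - h a := by
  have hd : IsDiscrete (range ((↑) : ℤ → ℝ)) := by
    rw [isDiscrete_iff_discreteTopology]
    exact Int.isClosedEmbedding_coe_real.isEmbedding.toHomeomorph.symm.isEmbedding.discreteTopology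
  have := isPreconnected_Icc.constant_of_mapsTo hd (hG.sub hh)
    (fun t ht => circ_coe_eq_coe_iff.1 (hGh t ht)) (left_mem_Icc.2 hab) (right_mem_Icc.2 hab)
  simp only [Pi.sub_apply] at this
  linarith

namespace HarmonicStructure.CutData

variable {d N : ℕ} {S : PCFFractal d N} {H : HarmonicStructure S} {m n : ℕ} (D : H.CutData m n)


/-- The lift of the `i`-th loop to `K⁰` starts at the copy `-` of the cut vertex, crosses no cut
vertex and ends at the copy `+`. So a lift of `f ∘ loop i` to `ℝ` increases by the jump of `u` at
the cut vertex. -/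
theorem Admissible.hasDegree {D : H.CutData m n} {ρ : Fin n → ℤ} {b : D.FundDomain}
    {u : C(D.FundDomain, ℝ)} (hu : D.Admissible ρ b u) {f : C(S.Pt, Circ)}
    (hf : ∀ p, f (D.proj p) = ((u p : ℝ) : Circ)) (i : Fin n) :
    HasDegree (f.comp (D.loop i)) (ρ i) := by
  let g : C(ℝ, Circ) := (f.comp (D.loop i)).comp ⟨((↑) : ℝ → Circ), AddCircle.continuous_mk' 1⟩
  obtain ⟨e₀, he₀⟩ := QuotientAddGroup.mk_surjective (g 0)
  obtain ⟨G, ⟨-, hG⟩, -⟩ :=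
    (AddCircle.isCoveringMap_coe (1 : ℝ)).existsUnique_continuousMap_lifts g 0 e₀ he₀
  have hGg : ∀ t : ℝ, ((G t : ℝ) : Circ) = f (D.loop i (t : Circ)) := fun t => congrFun hG t
  refine ⟨G, hGg, ?_⟩
  -- On each piece of the loop, `G` and the values of `u` on the copy of the cell differ by a
  -- constant.
  have hpiece : ∀ k < (D.ι i).length, ∀ x y, S.mapWord (D.word i k) x = (D.ι i).getVert k →
      S.mapWord (D.word i k) y = (D.ι i).getVert (k + 1) →
      G (D.time i (k + 1)) - G (D.time i k) = u (D.pt (D.word i k) y) - u (D.pt (D.word i k) x) := by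
    intro k hk x y hx hy
    have hle := D.time_le i k hk
    have hemb : IsClosedEmbedding (S.mapWord (D.word i k)) :=
      (S.continuous_mapWord _).isClosedEmbedding (S.mapWord_injective _)
    choose! ξ hξ using fun t ht => D.loop_mem_cell i k hk t ht
    have hξc : ContinuousOn ξ (Icc (D.time i k) (D.time i (k + 1))) := by
      rw [hemb.isInducing.continuousOn_iff]
      refine ContinuousOn.congr (f := fun t : ℝ => D.loop i (t : Circ)) ?_ hξ
      exact ((D.loop i).continuous.comp (AddCircle.continuous_mk' 1)).continuousOn
    have h := sub_eq_sub_of_coe_eq hle (G := G) (h := fun t => u (D.pt (D.word i k) (ξ t)))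
      G.continuous.continuousOn
      ((u.continuous.comp (D.continuous_pt _)).comp_continuousOn hξc) fun t ht => by
        rw [hGg, ← hf, D.proj_pt, hξ t ht]
    have h1 : ξ (D.time i k) = x := S.mapWord_injective _ (by
      rw [hξ _ (left_mem_Icc.2 hle), D.loop_time i k hk.le, hx])
    have h2 : ξ (D.time i (k + 1)) = y := S.mapWord_injective _ (by
      rw [hξ _ (right_mem_Icc.2 hle), D.loop_time i (k + 1) hk, hy])
    rw [h, h1, h2]
  have hstart : ∀ k < (D.ι i).length, ∃ x, S.mapWord (D.word i k) x = (D.ι i).getVert k :=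
    fun k hk => by
      rw [← D.loop_time i k hk.le]
      exact D.loop_mem_cell i k hk _ (left_mem_Icc.2 (D.time_le i k hk))
  have hend : ∀ k < (D.ι i).length, ∃ y, S.mapWord (D.word i k) y = (D.ι i).getVert (k + 1) :=
    fun k hk => by
      rw [← D.loop_time i (k + 1) hk]
      exact D.loop_mem_cell i k hk _ (right_mem_Icc.2 (D.time_le i k hk))
  choose! x hx using hstart
  choose! y hy using hend
  have hpos := D.length_pos i
  -- Consecutive cells are glued at the vertex between them, since the cycle meets no cut vertex
  -- in between.
  have hglue : ∀ k, k + 1 < (D.ι i).length →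
      D.pt (D.word i (k + 1)) (x (k + 1)) = D.pt (D.word i k) (y k) := by
    intro k hk
    refine D.pt_eq_pt_iff.2 ⟨(hx _ hk).trans (hy k (by omega)).symm, fun j hj => ?_⟩
    exfalso
    rw [hx _ hk] at hj
    by_cases hij : j = i
    · subst hij
      have := (D.ι_isCycle j).getVert_injOn' (x₁ := k + 1) (x₂ := 0)
        (show k + 1 ≤ _ by omega) (show 0 ≤ _ by omega) (by rw [hj, SimpleGraph.Walk.getVert_zero])
      omega
    · refine D.cut_notMem j i (Ne.symm hij) ?_
      rw [← hj]
      exact (D.ι i).getVert_mem_support _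
  have hsum : ∀ k < (D.ι i).length, G (D.time i (k + 1)) - G (D.time i 0) =
      u (D.pt (D.word i k) (y k)) - u (D.pt (D.word i 0) (x 0)) := by
    intro k
    induction k with
    | zero => exact fun hk => hpiece 0 hk _ _ (hx 0 hk) (hy 0 hk)
    | succ k ih =>
      intro hk
      have h1 := ih (by omega)
      have h2 := hpiece (k + 1) hk _ _ (hx _ hk) (hy _ hk)
      rw [hglue k hk] at h2
      linarith
  obtain ⟨l, hl⟩ : ∃ l, (D.ι i).length = l + 1 := ⟨_, (Nat.succ_pred_eq_of_pos hpos).symm⟩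
  have h := hsum l (by omega)
  have hplus : D.IsPlusCopy i (D.pt (D.word i l) (y l)) := by
    refine ⟨D.word i l, ?_, y l, ?_, rfl⟩
    · have := D.last_mem i
      rwa [hl, Nat.add_sub_cancel] at this
    · rw [hy l (by omega), ← hl, SimpleGraph.Walk.getVert_length]
  have hminus : D.IsMinusCopy i (D.pt (D.word i 0) (x 0)) :=
    ⟨D.word i 0, D.first_notMem i, x 0, by
      rw [hx 0 hpos, SimpleGraph.Walk.getVert_zero], rfl⟩
  rw [← hl, D.time_length, D.time_zero, hu.2 i _ _ hplus hminus] at h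
  rw [h]
  ring

end HarmonicStructure.CutData

/-! ### The Euler–Lagrange equation -/

theorem signedRep_coe {a : ℝ} (ha : |a| < 1 / 2) : signedRep (a : Circ) = a := by
  rw [abs_lt] at ha
  exact AddCircle.equivIoc_coe_of_mem ⟨by linarith, by linarith⟩

/-- A quadratic polynomial that is bounded below by its value at `0` has no linear term. -/
theorem eq_zero_of_forall_nonneg {B Q : ℝ} (h : ∀ t : ℝ, 0 ≤ t * B + t ^ 2 * Q) : B = 0 := by
  have h1 := discrim_le_zero (a := Q) (b := B) (c := 0) fun t => by
    have := h t
    linarith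
  simp only [discrim, mul_zero, sub_zero] at h1
  exact pow_eq_zero_iff two_ne_zero |>.1 (le_antisymm h1 (sq_nonneg B))

namespace HarmonicStructure

variable {d N : ℕ} {S : PCFFractal d N} (H : HarmonicStructure S)

theorem circleLaplacian_eq_bondSum [DecidableEq S.Pt] {n : ℕ} {z : S.Pt} (hz : z ∈ S.V n)
    (f : S.Pt → Circ) : H.circleLaplacian n f z =
      H.bondSum n fun x y => if x = z then signedRep (f y - f x) else 0 := by
  rw [bondSum_apply, Finset.sum_eq_single z]
  · simp [circleLaplacian]
  · intro x _ hx
    simp [hx]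
  · exact fun h => (h (S.mem_vert.2 hz)).elim

theorem rWord_le_pow {q : ℝ} (hq : ∀ i, H.r i ≤ q) {k : ℕ} (v : Fin k → Fin N) :
    H.rWord v ≤ q ^ k := by
  simpa [rWord] using Finset.prod_le_prod (s := Finset.univ) (f := fun j => H.r (v j))
    (g := fun _ => q) (fun j _ => (H.r_pos _).le) fun j _ => hq _

/-- Functions of bounded energy vary little across the bonds of a fine level, since each bond lies
in a cell of that level. -/
theorem exists_abs_sub_lt (B : ℝ) {ε : ℝ} (hε : 0 < ε) :
    ∃ k₀, ∀ k ≥ k₀, ∀ u : S.Pt → ℝ, H.energy k u ≤ B → ∀ (v : Fin k → Fin N),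
      ∀ x ∈ S.V 0, ∀ y ∈ S.V 0, |u (S.mapWord v y) - u (S.mapWord v x)| < ε := by
  obtain ⟨q, hq0, hq1, hq⟩ := H.exists_r_le
  obtain ⟨C, hC0, hC⟩ := H.exists_abs_sub_le_of_finiteResistance (n := 0)
    fun x hx y hy => H.finiteResistance_zero hx hy
  have hlim : Tendsto (fun k : ℕ => C * √(q ^ k * |B|)) atTop (𝓝 0) := by
    have h := (tendsto_pow_atTop_nhds_zero_of_lt_one hq0.le hq1).mul_const |B|
    have h2 := ((Real.continuous_sqrt.tendsto _).comp h).const_mul C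
    simpa using h2
  obtain ⟨k₀, hk₀⟩ := eventually_atTop.1 (hlim.eventually_lt_const hε)
  refine ⟨k₀, fun k hk u hu v x hx y hy => lt_of_le_of_lt ?_ (hk₀ k hk)⟩
  refine (hC (u ∘ S.mapWord v) x hx y hy).trans (mul_le_mul_of_nonneg_left ?_ hC0)
  refine Real.sqrt_le_sqrt ((H.energy_comp_mapWord_le 0 u v).trans ?_)
  rw [zero_add]
  exact mul_le_mul (H.rWord_le_pow hq v) (hu.trans (le_abs_self B)) (H.energy_nonneg _ _)
    (by positivity)

theorem bondSum_congr_word {k : ℕ} {g h : S.Pt → S.Pt → ℝ} (hg : ∀ x, g x x = 0)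
    (hh : ∀ x, h x x = 0)
    (hgh : ∀ v : Fin k → Fin N, ∀ x ∈ S.V 0, ∀ y ∈ S.V 0,
      g (S.mapWord v x) (S.mapWord v y) = h (S.mapWord v x) (S.mapWord v y)) :
    H.bondSum k g = H.bondSum k h := by
  rw [← zero_add k, H.bondSum_add 0 k g hg, H.bondSum_add 0 k h hh]
  exact Finset.sum_congr rfl fun v _ => congrArg _ (H.bondSum_congr (hgh v))

namespace CutData

variable {H} {m n : ℕ} {D : H.CutData m n} {ρ : Fin n → ℤ} {b : D.FundDomain}
  {u : C(D.FundDomain, ℝ)}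

/-- The energies of a minimiser restricted to the cells are bounded uniformly in the level. -/
theorem IsEnergyMinimizer.exists_energy_le (hu : D.IsEnergyMinimizer ρ b u) :
    ∃ B, ∀ k (w : Fin (m + 1) → Fin N), H.energy k (fun x => u (D.pt w x)) ≤ B := by
  refine ⟨(D.limEnergy u).toReal, fun k w => ?_⟩
  have h1 : D.domEnergy k u ≤ (D.limEnergy u).toReal :=
    (ENNReal.ofReal_le_iff_le_toReal hu.2.1.ne).1 (le_iSup (fun k => ENNReal.ofReal
      (D.domEnergy k u)) k)
  have h2 : (H.rWord w)⁻¹ * H.energy k (fun x => u (D.pt w x)) ≤ D.domEnergy k u :=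
    Finset.single_le_sum
      (f := fun w => (H.rWord w)⁻¹ * H.energy k (fun x => u (D.pt w x)))
      (fun w _ => mul_nonneg (inv_nonneg.2 (H.rWord_pos w).le) (H.energy_nonneg _ _))
      (Finset.mem_univ w)
  have h3 : 1 ≤ (H.rWord w)⁻¹ := (one_le_inv₀ (H.rWord_pos w)).2
    (Finset.prod_le_one (fun i _ => (H.r_pos _).le) fun i _ => (H.r_lt_one _).le)
  exact (le_mul_of_one_le_left (H.energy_nonneg _ _) h3).trans (h2.trans h1)

/-- The first variation of the energy along functions on `K` vanishes at a minimiser. -/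
theorem IsEnergyMinimizer.first_variation (hu : D.IsEnergyMinimizer ρ b u) (k : ℕ)
    (η : S.Pt → ℝ) :
    ∑ w : Fin (m + 1) → Fin N, (H.rWord w)⁻¹ * H.bondSum k (fun x y =>
      (u (D.pt w y) - u (D.pt w x)) * (η (S.mapWord w y) - η (S.mapWord w x))) = 0 := by
  refine eq_zero_of_forall_nonneg
    (Q := ∑ w : Fin (m + 1) → Fin N, (H.rWord w)⁻¹ * H.energy k (η ∘ S.mapWord w)) fun t => ?_
  have hmin := hu.2.2.2 k _ (hu.1.add_comp_proj η t)
  have hexp : D.domEnergy k (fun p => u p + t * (η (D.proj p) - η (D.proj b))) =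
      D.domEnergy k u + (t * ∑ w : Fin (m + 1) → Fin N, (H.rWord w)⁻¹ * H.bondSum k (fun x y =>
        (u (D.pt w y) - u (D.pt w x)) * (η (S.mapWord w y) - η (S.mapWord w x))) +
      t ^ 2 * ∑ w : Fin (m + 1) → Fin N, (H.rWord w)⁻¹ * H.energy k (η ∘ S.mapWord w)) := by
    simp only [domEnergy, Finset.mul_sum, ← Finset.sum_add_distrib]
    refine Finset.sum_congr rfl fun w _ => ?_
    simp only [energy_eq_bondSum]
    rw [mul_left_comm t, mul_left_comm (t ^ 2), ← mul_add, ← mul_add]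
    congr 1
    rw [← smul_eq_mul t, ← smul_eq_mul (t ^ 2), ← map_smul, ← map_smul, ← map_add, ← map_add]
    congr 1
    funext x y
    simp only [D.proj_pt, Pi.add_apply, Pi.smul_apply, smul_eq_mul, Function.comp_apply]
    ring
  rw [hexp] at hmin
  linarith

/-- On fine levels the circle-valued Laplacian of the map below a minimiser is the linear Laplacian
of the minimiser on the cut space, which is its first variation along the indicator of a vertex.
There is no constraint at the boundary, so it vanishes there as well. -/
theorem IsEnergyMinimizer.eventually_circleLaplacian_eq_zero (hu : D.IsEnergyMinimizer ρ b u)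
    {f : S.Pt → Circ} (hf : ∀ p, f (D.proj p) = ((u p : ℝ) : Circ)) :
    ∀ᶠ l in atTop, ∀ z ∈ S.V l, H.circleLaplacian l f z = 0 := by
  classical
  obtain ⟨B, hB⟩ := hu.exists_energy_le
  -- Differences below `1/2` are their own representatives in `(-1/2, 1/2]`.
  obtain ⟨k₀, hk₀⟩ := H.exists_abs_sub_lt B (ε := 1 / 2) (by norm_num)
  refine eventually_atTop.2 ⟨k₀ + (m + 1), fun l hl z hz => ?_⟩
  obtain ⟨k, rfl⟩ : ∃ k, l = k + (m + 1) := ⟨l - (m + 1), by omega⟩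
  have hsr : signedRep 0 = 0 := signedRep_coe (a := 0) (by norm_num)
  let L (w : Fin (m + 1) → Fin N) : S.Pt → S.Pt → ℝ := fun x y =>
    if S.mapWord w x = z then u (D.pt w y) - u (D.pt w x) else 0
  have hlin : H.circleLaplacian (k + (m + 1)) f z =
      ∑ w : Fin (m + 1) → Fin N, (H.rWord w)⁻¹ * H.bondSum k (L w) := by
    rw [H.circleLaplacian_eq_bondSum hz, H.bondSum_add k (m + 1) _ fun x => by simp [hsr]]
    refine Finset.sum_congr rfl fun w _ => congrArg _ ?_
    refine H.bondSum_congr_word (fun x => by simp [hsr]) (fun x => by simp [L])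
      fun v x hx y hy => ?_
    simp only [L]
    congr 1
    rw [← D.proj_pt, ← D.proj_pt, hf, hf, ← AddCircle.coe_sub]
    exact signedRep_coe (hk₀ k (by omega) _ (hB k w) v x hx y hy)
  have hvar := hu.first_variation k fun x => if x = z then 1 else 0
  have hL : ∀ w : Fin (m + 1) → Fin N, H.bondSum k (fun x y => (u (D.pt w y) - u (D.pt w x)) *
      ((if S.mapWord w y = z then 1 else 0) - (if S.mapWord w x = z then 1 else 0))) =
      -2 * H.bondSum k (L w) := fun w => by
    have h1 : (fun x y => (u (D.pt w y) - u (D.pt w x)) *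
        ((if S.mapWord w y = z then 1 else 0) - (if S.mapWord w x = z then 1 else 0))) =
        -((fun x y => L w y x) + L w) := by
      funext x y
      simp only [L, Pi.neg_apply, Pi.add_apply]
      split_ifs <;> ring
    rw [h1, map_neg, map_add, bondSum_swap]
    ring
  simp only [hL] at hvar
  rw [hlin]
  simp only [mul_left_comm _ (-2 : ℝ), ← Finset.mul_sum] at hvar
  linarith

end CutData

end HarmonicStructure

/-! ### Harmonic maps of prescribed degree -/

theorem mainTheorem5 {d N : ℕ} (S : PCFFractal d N) (H : HarmonicStructure S)
    (m n : ℕ) (D : H.CutData m n)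
    {R : Type*} [CommRing R] [Nontrivial R] (hbasis : D.IsCycleBasis R)
    (ρ : Fin n → ℤ) (b : D.FundDomain) (hb : D.proj b ∈ S.V 0) :
    ∃ f : C(S.Pt, Circ),
      H.IsHarmonicMap f ∧
      (∀ i, HasDegree (f.comp (D.loop i)) (ρ i)) ∧
      (∀ v ∈ S.V 0, H.HasNormalDeriv f v 0) ∧
      ∃ (u : C(D.FundDomain, ℝ)) (U : C(D.CoveringSpace ρ, ℝ)),
        D.IsEnergyMinimizer ρ b u ∧
        (∀ s p, U (D.sheet ρ s p) = u p + s) ∧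
        (∀ s p, f (D.proj p) = ((U (D.sheet ρ s p) : ℝ) : Circ)) := by
  obtain ⟨u, hu⟩ := D.exists_isEnergyMinimizer ρ b hb
  obtain ⟨f, hf⟩ := hu.1.exists_circleMap
  obtain ⟨U, hU⟩ := hu.1.exists_coveringMap
  have hΔ := hu.eventually_circleLaplacian_eq_zero hf
  refine ⟨f, ?_, hu.1.hasDegree hf, fun v hv => ?_, u, U, hu, hU, fun s p => ?_⟩
  · filter_upwards [hΔ] with l hl x hx _ using hl x hx
  · refine tendsto_const_nhds.congr' ?_
    filter_upwards [hΔ] with l hl using (hl v (S.V_zero_subset l hv)).symm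
  · rw [hf, hU]
    exact circ_coe_eq_coe_iff.2 ⟨-s, by simp⟩
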